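/- **Setting.** Let $d,N\ge 1$ and let $s_1,\dots,s_N:\mathbb R^d\to\mathbb R$ be differentiable with $\|\nabla s_j(w)-\nabla s_j(v)\|\le L\|w-v\|$ and $\|\nabla s_j(w)\|\le B$ for all $w,v,j$, where $L\ge 0$ and $B>0$. Let $S(w)=(s_1(w),\dots,s_N(w))$, let $\phi_l(S)$ be the sum of the $l$ largest coordinates of $S$, let $0\le m<n\le N$, $f^l(w)=\phi_l(S(w))$ and $F=f^n-f^m$, and assume $F^*=\inf F>-\infty$. Let $\rho=NL$ and $0<\mu$ with $\mu^{-1}>\rho$. For $l\in\{m,n\}$ put $v_{\mu f^l}(w)=\arg\min_v\{f^l(v)+\frac1{2\mu}\|v-w\|^2\}$, $g^l(v,\lambda)=l\lambda+\sum_{j=1}^N[s_j(v)-\lambda]_+$, and $\Lambda^*_l(w)=\arg\min_{\lambda\in\mathbb R}g^l(v_{\mu f^l}(w),\lambda)$. Let $L_\mu=\frac{2}{\mu-\mu^2\rho}$ and $0<\gamma\le 1/L_\mu$. **Inner method** $\mathrm{SGD}(w,\lambda,T,\mu,l)$ (sample size $1\le J\le N$). Start from $(v^{(0)},\lambda^{(0)})=(w,\lambda)$.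 For $t=0,\dots,T-1$ draw $\mathcal J_t$ uniformly among the subsets of $\{1,\dots,N\}$ of size $J$, independently of everything else, and set $$G_v^{(t)}=\tfrac NJ\sum_{j\in\mathcal J_t}\nabla s_j(v^{(t)})\mathbf 1(s_j(v^{(t)})>\lambda^{(t)}),\qquad G_\lambda^{(t)}=l-\tfrac NJ\sum_{j\in\mathcal J_t}\mathbf 1(s_j(v^{(t)})>\lambda^{(t)}),$$ $$v^{(t+1)}=\arg\min_v\Big\{\langle G_v^{(t)},v\rangle+\tfrac{\|v-w\|^2}{2\mu}+\tfrac{\|v-v^{(t)}\|^2}{2\eta_t}\Big\},\qquad \lambda^{(t+1)}=\lambda^{(t)}-\theta_tG_\lambda^{(t)}$$ (with $v^{(t+1)}=v^{(t)}$ if $\eta_t=0$). Return $\frac1T\sum_{t=0}^{T-1}(v^{(t)},\lambda^{(t)})$. **Outer method.** Given $w^{(0)},\bar\lambda_m^{(0)},\bar\lambda_n^{(0)}$, for $k=0,\dots,K-1$ let $(\bar v_l^{(k)},\bar\lambda_l^{(k+1)})=\mathrm{SGD}(w^{(k)},\bar\lambda_l^{(k)},T_k^l,\mu,l)$ for $l=m,n$,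 and $w^{(k+1)}=w^{(k)}-\gamma\mu^{-1}(\bar v_m^{(k)}-\bar v_n^{(k)})$. Return $\bar v_n^{(\bar k)}$ with $\bar k$ uniform on $\{0,\dots,K-1\}$ and independent of the samples. The parameters of the call for $l$ in iteration $k$ are, for all $t$, $$\theta_t=\frac{\mathrm{dist}(\bar\lambda_l^{(k)},\Lambda_l^*(w^{(k)}))}{\sqrt{T_k^l}\,N},\qquad \eta_t=\frac{\|v_{\mu f^l}(w^{(k)})-w^{(k)}\|}{NB\sqrt{T_k^l}},$$ $$T_k^l=\left\lceil\max\left\{\frac{144N^2D_l^2(k+1)^2}{(\mu^{-1}-\rho)^2},\frac{4N^2\mu^2l^2B^2(k+1)^2}{(\mu^{-1}-\rho)^2},\frac{6\mu l^2B^2(k+1)}{2(\mu^{-1}-\rho)^2}\right\}\right\rceil,$$ $$D_l=\max\left\{\mathrm{dist}(\bar\lambda_l^{(0)},\Lambda_l^*(w^{(0)})),\ \tfrac12\big(\tfrac1\mu-\rho\big)+\tfrac{\mu l^2B^2}2+B+\tfrac{B}{1-\mu\rho}\big(\tfrac{2\gamma}\mu+\gamma nB+\gamma mB\big)\right\}.$$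 **Claim.** For $\epsilon>0$ put $$K_\epsilon=\max\left\{\frac{16\mu^2}{\gamma\min\{1,\mu^2\}\epsilon^2}\big(F(v_{\mu f^m}(w^{(0)}))-F^*\big),\ \frac{96}{\min\{1,\mu^2\}\epsilon^2}\log\Big(\frac{96}{\min\{1,\mu^2\}\epsilon^2}\Big)\right\}.$$ For every integer $K\ge\max\{1,K_\epsilon\}$ (in particular for $K=\max\{1,\lceil K_\epsilon\rceil\}$) the output $\bar v_n^{(\bar k)}$ is a nearly $\epsilon$-critical point of $\min_w F(w)$: there are random vectors $\xi,w',w''$ with $\xi\in\partial f^n(w')-\partial f^m(w'')$ almost surely and $\max\{\mathbb E\|\xi\|,\mathbb E\|\bar v_n^{(\bar k)}-w'\|,\mathbb E\|\bar v_n^{(\bar k)}-w''\|\}\le\epsilon$. Here $\partial f(w)=\{\xi: f(v)\ge f(w)+\langle\xi,v-w\rangle+o(\|v-w\|)\text{ as }v\to w\}$. Moreover, with $K=\max\{1,\lceil K_\epsilon\rceil\}$ one has $K=\tilde O(\epsilon^{-2})$, and the total number of SGD iterations is $\sum_{k=0}^{K-1}(T_k^m+T_k^n)=\tilde O(\epsilon^{-6})$: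 there are constants $C,p$ that do not depend on $\epsilon$ such that for $0<\epsilon<1$ these quantities are at most $C\epsilon^{-2}(1+\log\frac1\epsilon)^p$ and $C\epsilon^{-6}(1+\log\frac1\epsilon)^p$. -/

import Mathlib

open MeasureTheory ProbabilityTheory Filter Topology Set
open scoped RealInnerProductSpace Gradient

namespace SoRR

noncomputable section

/-- The parameter space `ℝ^d` with the Euclidean norm. -/
abbrev E (d : ℕ) : Type := EuclideanSpace ℝ (Fin d)

/-! ### Sum of the top-`l` coordinates -/

/-- `ranked S i` is the `(i+1)`-th largest coordinate of the vector `S`. -/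
def ranked {N : ℕ} (S : Fin N → ℝ) (i : Fin N) : ℝ :=
  S (Tuple.sort (fun j => -S j) i)

theorem ranked_antitone {N : ℕ} (S : Fin N → ℝ) : Antitone (ranked S) := by
  intro i j hij
  have h := Tuple.monotone_sort (fun j => -S j) hij
  simp only [Function.comp_apply] at h
  unfold ranked
  linarith

/-- `φ_l(S)`, the sum of the `l` largest coordinates of `S`. -/
def topSum {N : ℕ} (l : ℕ) (S : Fin N → ℝ) : ℝ :=
  ∑ i : Fin N, if (i : ℕ) < l then ranked S i else 0

/-! ### Subgradients, proximal maps, critical points -/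

/-- The (Fréchet) subdifferential of `f` at `w`: all `ξ` with
`f v ≥ f w + ⟪ξ, v - w⟫ + o(‖v - w‖)` as `v → w`. -/
def subdiff {d : ℕ} (f : E d → ℝ) (w : E d) : Set (E d) :=
  {ξ | ∀ c : ℝ, 0 < c → ∀ᶠ v in 𝓝 w, f w + ⟪ξ, v - w⟫ - c * ‖v - w‖ ≤ f v}

/-- `v_{μ f}(w)`: the minimizer of `v ↦ f v + ‖v - w‖² / (2μ)`. -/
def prox {d : ℕ} (μ : ℝ) (f : E d → ℝ) (w : E d) : E d :=
  Classical.epsilon fun v => IsMinOn (fun u => f u + ‖u - w‖ ^ 2 / (2 * μ)) univ v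

/-- A random vector `W` is a nearly `ε`-critical point of `fn - fm`: there are random vectors
`ξ, W', W''` with `ξ ∈ ∂fn(W') - ∂fm(W'')` almost surely, and `𝔼‖ξ‖`, `𝔼‖W - W'‖` and
`𝔼‖W - W''‖` are all at most `ε`. -/
def IsNearlyCritical {d : ℕ} {Ω : Type*} [MeasurableSpace Ω] (P : Measure Ω)
    (fn fm : E d → ℝ) (ε : ℝ) (W : Ω → E d) : Prop :=
  ∃ ξ W' W'' : Ω → E d, Measurable ξ ∧ Measurable W' ∧ Measurable W'' ∧
    (∀ᵐ ω ∂P, ∃ a ∈ subdiff fn (W' ω), ∃ b ∈ subdiff fm (W'' ω), ξ ω = a - b) ∧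
    Integrable ξ P ∧ Integrable (fun ω => W ω - W' ω) P ∧
    Integrable (fun ω => W ω - W'' ω) P ∧
    ∫ ω, ‖ξ ω‖ ∂P ≤ ε ∧ ∫ ω, ‖W ω - W' ω‖ ∂P ≤ ε ∧ ∫ ω, ‖W ω - W'' ω‖ ∂P ≤ ε

/-! ### Stochastic subgradient descent for the proximal subproblem -/

/-- The proximal subgradient update
`argmin_u ⟪G, u⟫ + ‖u - w‖²/(2μ) + ‖u - v‖²/(2η)`, in closed form. For `η = 0` the value is `v`,
the limit of the minimizers as `η → 0`. -/
def proxStep {d : ℕ} (μ η : ℝ) (w G v : E d) : E d :=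
  (μ + η)⁻¹ • (μ • v + η • w - (η * μ) • G)

theorem proxStep_zero {d : ℕ} {μ : ℝ} (hμ : 0 < μ) (w G v : E d) :
    proxStep μ 0 w G v = v := by
  simp [proxStep, smul_smul, hμ.ne']

theorem proxStep_objective {d : ℕ} {μ η : ℝ} (hμ : 0 < μ) (hη : 0 < η) (w G v u : E d) :
    ⟪G, u⟫ + ‖u - w‖ ^ 2 / (2 * μ) + ‖u - v‖ ^ 2 / (2 * η) =
      (⟪G, proxStep μ η w G v⟫ + ‖proxStep μ η w G v - w‖ ^ 2 / (2 * μ) +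
        ‖proxStep μ η w G v - v‖ ^ 2 / (2 * η)) +
      (1 / (2 * μ) + 1 / (2 * η)) * ‖u - proxStep μ η w G v‖ ^ 2 := by
  set p := proxStep μ η w G v with hp
  have hs : μ + η ≠ 0 := by positivity
  have h1 : (η * μ) • G = -(η • (p - w) + μ • (p - v)) := by
    have h2 : (μ + η) • p = μ • v + η • w - (η * μ) • G := by
      rw [hp, proxStep, smul_smul, mul_inv_cancel₀ hs, one_smul]
    have h3 : (η * μ) • G = μ • v + η • w - (μ + η) • p := by rw [h2]; abel
    rw [h3]; module
  have h4 : η * μ * ⟪G, u - p⟫ = -(η * ⟪p - w, u - p⟫ + μ * ⟪p - v, u - p⟫) := by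
    have := congrArg (fun x : E d => ⟪x, u - p⟫) h1
    simpa only [inner_smul_left, inner_neg_left, inner_add_left, conj_trivial] using this
  have h5 : ‖u - w‖ ^ 2 = ‖u - p‖ ^ 2 + 2 * ⟪p - w, u - p⟫ + ‖p - w‖ ^ 2 := by
    rw [show u - w = (u - p) + (p - w) by abel, norm_add_sq_real, real_inner_comm]
  have h6 : ‖u - v‖ ^ 2 = ‖u - p‖ ^ 2 + 2 * ⟪p - v, u - p⟫ + ‖p - v‖ ^ 2 := by
    rw [show u - v = (u - p) + (p - v) by abel, norm_add_sq_real, real_inner_comm]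
  have h7 : ⟪G, u⟫ = ⟪G, p⟫ + ⟪G, u - p⟫ := by rw [inner_sub_right]; ring
  have h8 : ⟪G, u - p⟫ = -(⟪p - w, u - p⟫ / μ + ⟪p - v, u - p⟫ / η) := by
    field_simp
    linarith
  rw [h5, h6, h7, h8]
  field_simp
  ring

/-- `proxStep` is the unique minimizer of the proximal subgradient objective. -/
theorem proxStep_isMinOn_iff {d : ℕ} {μ η : ℝ} (hμ : 0 < μ) (hη : 0 < η) (w G v x : E d) :
    IsMinOn (fun u => ⟪G, u⟫ + ‖u - w‖ ^ 2 / (2 * μ) + ‖u - v‖ ^ 2 / (2 * η)) univ x ↔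
      x = proxStep μ η w G v := by
  have hc : 0 < 1 / (2 * μ) + 1 / (2 * η) := by positivity
  constructor
  · intro h
    have h1 := isMinOn_iff.1 h (proxStep μ η w G v) (mem_univ _)
    beta_reduce at h1
    rw [proxStep_objective hμ hη w G v x] at h1
    have h2 : ‖x - proxStep μ η w G v‖ ^ 2 ≤ 0 := by
      by_contra h3
      push Not at h3
      have := mul_pos hc h3
      linarith
    have h3 : ‖x - proxStep μ η w G v‖ = 0 := by
      have := sq_nonneg ‖x - proxStep μ η w G v‖
      exact pow_eq_zero_iff (two_ne_zero) |>.1 (le_antisymm h2 this)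
    exact sub_eq_zero.1 (norm_eq_zero.1 h3)
  · rintro rfl
    refine isMinOn_iff.2 fun u _ => ?_
    beta_reduce
    rw [proxStep_objective hμ hη w G v u]
    have := mul_nonneg hc.le (sq_nonneg ‖u - proxStep μ η w G v‖)
    linarith

variable {d N : ℕ}

/-- Stochastic subgradient with respect to `v` for the sampled index set `A` of size `J`. -/
def gradV (s : Fin N → E d → ℝ) (J : ℕ) (A : Finset (Fin N)) (v : E d) (lam : ℝ) : E d :=
  ((N : ℝ) / J) • ∑ j ∈ A, if lam < s j v then ∇ (s j) v else 0

/-- Stochastic subgradient with respect to `λ` for the sampled index set `A` of size `J`. -/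
def gradLam (s : Fin N → E d → ℝ) (J l : ℕ) (A : Finset (Fin N)) (v : E d) (lam : ℝ) : ℝ :=
  l - ((N : ℝ) / J) * ∑ j ∈ A, if lam < s j v then (1 : ℝ) else 0

/-- The iterates `(v^(t), λ^(t))` of stochastic subgradient descent started at `(w, lam)`, with
step sizes `η t`, `θ t` and sampled index sets `A t`. -/
def sgdIter (s : Fin N → E d → ℝ) (J l : ℕ) (μ : ℝ) (η θ : ℕ → ℝ) (A : ℕ → Finset (Fin N))
    (w : E d) (lam : ℝ) : ℕ → E d × ℝ
  | 0 => (w, lam)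
  | t + 1 =>
    let z := sgdIter s J l μ η θ A w lam t
    (proxStep μ (η t) w (gradV s J (A t) z.1 z.2) z.1,
      z.2 - θ t * gradLam s J l (A t) z.1 z.2)

/-- The output of `T` iterations of stochastic subgradient descent: the average of the first `T`
iterates `(v^(0), λ^(0)), …, (v^(T-1), λ^(T-1))`. -/
def sgd (s : Fin N → E d → ℝ) (J l : ℕ) (μ : ℝ) (η θ : ℕ → ℝ) (A : ℕ → Finset (Fin N))
    (w : E d) (lam : ℝ) (T : ℕ) : E d × ℝ :=
  (T : ℝ)⁻¹ • ∑ t ∈ Finset.range T, sgdIter s J l μ η θ A w lam t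

/-! ### The problem, the parameters, and the approximate gradient descent method -/

/-- The data of the problem and the inputs of the method (no properties are recorded here). The
range is `m + 1, …, n`, `L` and `B` are the smoothness and gradient bounds, `J` the sample size,
`μ` the smoothing parameter, `γ` the outer step size. The two inner runs of every outer iteration
are labelled by a Boolean: `false` is the run for `f^m`, `true` the run for `f^n`. -/
structure Setup (d N : ℕ) where
  /-- the component functions `s_j` -/
  s : Fin N → E d → ℝ
  m : ℕ
  n : ℕ
  L : ℝ
  B : ℝ
  J : ℕ
  μ : ℝ
  γ : ℝ
  w₀ : E d
  /-- the initial values of `λ` for the two inner runs -/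
  lam₀ : Bool → ℝ

namespace Setup

variable (S : Setup d N)

/-- `f^l(w) = φ_l(s_1(w), …, s_N(w))`. -/
def f (l : ℕ) (w : E d) : ℝ := topSum l fun j => S.s j w

/-- The objective `F = f^n - f^m`. -/
def F (w : E d) : ℝ := S.f S.n w - S.f S.m w

/-- `F^* = inf F`. -/
def Fstar : ℝ := ⨅ w, S.F w

/-- `ρ = N L`. -/
def ρ : ℝ := N * S.L

/-- `g^l(v, λ) = l λ + ∑_j [s_j(v) - λ]_+`. -/
def g (l : ℕ) (v : E d) (lam : ℝ) : ℝ := l * lam + ∑ j, max (S.s j v - lam) 0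

/-- `v_{μ f^l}(w)`. -/
def proxF (l : ℕ) (w : E d) : E d := prox S.μ (S.f l) w

/-- The set of minimizers of `λ ↦ g^l(v_{μ f^l}(w), λ)`. -/
def LambdaStar (l : ℕ) (w : E d) : Set ℝ :=
  {lam | IsMinOn (fun x => S.g l (S.proxF l w) x) univ lam}

/-- `L_μ = 2 / (μ - μ² ρ)`, the Lipschitz constant of the gradient of the smoothed objective. -/
def Lμ : ℝ := 2 / (S.μ - S.μ ^ 2 * S.ρ)

/-- The rank handled by the run `b`. -/
def level (b : Bool) : ℕ := if b then S.n else S.m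

/-- The constant `D_l`. -/
def D (b : Bool) : ℝ :=
  max (Metric.infDist (S.lam₀ b) (S.LambdaStar (S.level b) S.w₀))
    (1 / 2 * (1 / S.μ - S.ρ) + S.μ * (S.level b) ^ 2 * S.B ^ 2 / 2 + S.B +
      S.B / (1 - S.μ * S.ρ) * (2 * S.γ / S.μ + S.γ * S.n * S.B + S.γ * S.m * S.B))

/-- The number of inner iterations of the run `b` in outer iteration `k`. -/
def T (k : ℕ) (b : Bool) : ℕ :=
  ⌈max (max
      (144 * (N : ℝ) ^ 2 * S.D b ^ 2 * (k + 1) ^ 2 / (S.μ⁻¹ - S.ρ) ^ 2)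
      (4 * (N : ℝ) ^ 2 * S.μ ^ 2 * (S.level b) ^ 2 * S.B ^ 2 * (k + 1) ^ 2 / (S.μ⁻¹ - S.ρ) ^ 2))
      (6 * S.μ * (S.level b) ^ 2 * S.B ^ 2 * (k + 1) / (2 * (S.μ⁻¹ - S.ρ) ^ 2))⌉₊

/-- The step size `θ` of the run `b` in outer iteration `k`, started at `(w, lam)`. -/
def θ (k : ℕ) (b : Bool) (w : E d) (lam : ℝ) : ℝ :=
  Metric.infDist lam (S.LambdaStar (S.level b) w) / (Real.sqrt (S.T k b) * N)

/-- The step size `η` of the run `b` in outer iteration `k`, started at `w`. -/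
def η (k : ℕ) (b : Bool) (w : E d) : ℝ :=
  ‖S.proxF (S.level b) w - w‖ / (N * S.B * Real.sqrt (S.T k b))

/-- The inner run `b` of outer iteration `k`, started at `(w, lam)`; `A k b t` is the index set
sampled in its step `t`. -/
def innerRun (A : ℕ → Bool → ℕ → Finset (Fin N)) (k : ℕ) (b : Bool) (w : E d) (lam : ℝ) :
    E d × ℝ :=
  sgd S.s S.J (S.level b) S.μ (fun _ => S.η k b w) (fun _ => S.θ k b w lam) (A k b) w lam (S.T k b)

/-- The state `(w^(k), (λ̄_m^(k), λ̄_n^(k)))` of approximate gradient descent. -/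
def agd (A : ℕ → Bool → ℕ → Finset (Fin N)) : ℕ → E d × (Bool → ℝ)
  | 0 => (S.w₀, S.lam₀)
  | k + 1 =>
    let z := agd A k
    (z.1 - (S.γ * S.μ⁻¹) •
        ((S.innerRun A k false z.1 (z.2 false)).1 - (S.innerRun A k true z.1 (z.2 true)).1),
      fun b => (S.innerRun A k b z.1 (z.2 b)).2)

/-- `v̄_n^(k)`. -/
def vbar (A : ℕ → Bool → ℕ → Finset (Fin N)) (k : ℕ) : E d :=
  (S.innerRun A k true (S.agd A k).1 ((S.agd A k).2 true)).1

/-- The bound on the number of outer iterations for accuracy `ε`. -/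
def Kbound (ε : ℝ) : ℝ :=
  max (16 * S.μ ^ 2 / (S.γ * min 1 (S.μ ^ 2) * ε ^ 2) * (S.F (S.proxF S.m S.w₀) - S.Fstar))
    (96 / (min 1 (S.μ ^ 2) * ε ^ 2) * Real.log (96 / (min 1 (S.μ ^ 2) * ε ^ 2)))

/-- The least admissible number of outer iterations: `Kbound ε` rounded up, and at least one. -/
def K (ε : ℝ) : ℕ := max 1 ⌈S.Kbound ε⌉₊

/-- The total number of stochastic subgradient steps in `K` outer iterations. -/
def totalSteps (K : ℕ) : ℕ := ∑ k ∈ Finset.range K, (S.T k false + S.T k true)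

end Setup

/-- The randomness of the method with `K` outer iterations: the sampled index sets are independent
and uniform among the subsets of size `J`, and the output index `kbar` is uniform on
`{0, …, K - 1}` and independent of them. -/
structure IsSampling {Ω : Type*} [MeasurableSpace Ω] (P : Measure Ω) (N J K : ℕ)
    (A : ℕ × Bool × ℕ → Ω → Finset (Fin N)) (kbar : Ω → ℕ) : Prop where
  measurable_A : ∀ i, Measurable (A i)
  law_A : ∀ i, P.map (A i) = uniformOn {a : Finset (Fin N) | a.card = J}
  indep_A : iIndepFun A P
  measurable_kbar : Measurable kbar
  law_kbar : P.map kbar = uniformOn {k : ℕ | k < K}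
  indep_kbar : IndepFun (fun ω i => A i ω) kbar P

end

end SoRR

namespace SoRR

/-! ### Ranked coordinates and the variational formula for the top-`l` sum -/

/-! Write `u_l` for the proximal point of `f^l` at `w`. The difference of the Moreau envelopes of
`f^n` and `f^m` (`smoothed`) lies between `F^*` and `F(u_m)`, and `μ⁻¹ (u_m - u_n)` acts as its
gradient in the one-sided quadratic bound `smoothed_le`. The outer method is gradient descent on
this surrogate with each `u_l` replaced by the output of an inner run. Hence `norm_u_sub_u_sq_le`
telescopes: `∑ ‖u_m - u_n‖²` is at most a constant plus twice the sum of the squared inner errors.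
As `μ⁻¹ (w - u_l)` is a subgradient of `f^l` at `u_l`, the witnesses are `ξ = μ⁻¹ (u_m - u_n)`, `w'
= u_n`, `w'' = u_m`, and only second moments at a random index remain to be bounded.

For the inner error, `topSum` is the minimum of `hinge` over `λ`, attained on a closed convex set of
thresholds. The proximal problem thus becomes a joint problem in `(v, λ)`, strongly convex in `v`
but merely sharp in `λ`. The tuned step sizes make the regret linear in the initial distances `‖u -
w‖` and `δ` (from `λ` to the optimal thresholds), while averaging over the sample leaves threshold
gap plus `τ ‖v - u‖²` on the other side (`le_average_stepTerm`). By linearity a bound on `𝔼 δ` is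
enough: if `𝔼 δ ≤ D`, run lengths of order `(k+1)²` give expected squared error at most
`1/(2(k+1))`.

The invariant `𝔼 δ ≤ D` is kept by warm starting (`integral_δ_le`). Sharpness bounds the error of
the returned `λ` by its gap plus `B ‖v - u‖`, and the optimal set moves in a Lipschitz way with `w`;
`D` dominates the sum of these contributions. The errors then add up to a harmonic sum of order `log
K`, which the choice of `K` absorbs. Run lengths of order `k²` add up to order `K³`, whence the
exponent 6.

Samples take finitely many values and each iteration uses finitely many of them, so measurability
and integrability cost nothing, even for proximal points picked by choice, and conditional
expectations are finite averages. -/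

/-- Pigeonhole: the indices of the `i + 1` largest coordinates of `x` and of the `N - i` smallest
coordinates of `y` together number `N + 1`, so some `j` belongs to both. Then `ranked x i ≤ x j ≤ y
j + δ ≤ ranked y i + δ`. -/
theorem ranked_le_ranked_add {N : ℕ} {x y : Fin N → ℝ} {δ : ℝ} (h : ∀ j, x j ≤ y j + δ)
    (i : Fin N) : ranked x i ≤ ranked y i + δ := by
  classical
  set p := Tuple.sort fun j => -x j
  set q := Tuple.sort fun j => -y j
  have hcard : Fintype.card (Fin N) <
      ((Finset.Iic i).image p).card + ((Finset.Ici i).image q).card := by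
    rw [Finset.card_image_of_injective _ p.injective,
      Finset.card_image_of_injective _ q.injective, Fin.card_Iic, Fin.card_Ici, Fintype.card_fin]
    have := i.2
    omega
  have hne : (((Finset.Iic i).image p) ∩ ((Finset.Ici i).image q)).Nonempty := by
    rw [← Finset.card_pos]
    have h1 := Finset.card_union_add_card_inter ((Finset.Iic i).image p) ((Finset.Ici i).image q)
    have h2 := Finset.card_le_univ (((Finset.Iic i).image p) ∪ ((Finset.Ici i).image q))
    omega
  obtain ⟨j, hj⟩ := hne
  simp only [Finset.mem_inter, Finset.mem_image, Finset.mem_Iic, Finset.mem_Ici] at hj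
  obtain ⟨⟨a, ha, hpa⟩, ⟨b, hb, hqb⟩⟩ := hj
  have h1 : ranked x i ≤ x j := by
    have := ranked_antitone x ha
    simpa only [ranked, ← hpa] using this
  have h2 : y j ≤ ranked y i := by
    have := ranked_antitone y hb
    simpa only [ranked, ← hqb] using this
  linarith [h j]

theorem abs_ranked_sub_le {N : ℕ} {x y : Fin N → ℝ} {δ : ℝ} (h : ∀ j, |x j - y j| ≤ δ)
    (i : Fin N) : |ranked x i - ranked y i| ≤ δ := by
  have h1 := ranked_le_ranked_add (x := x) (y := y) (δ := δ)
    (fun j => by linarith [(abs_le.1 (h j)).2]) i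
  have h2 := ranked_le_ranked_add (x := y) (y := x) (δ := δ)
    (fun j => by linarith [(abs_le.1 (h j)).1]) i
  rw [abs_le]
  constructor <;> linarith

theorem sum_ranked {N : ℕ} (x : Fin N → ℝ) (φ : ℝ → ℝ) :
    ∑ i, φ (ranked x i) = ∑ j, φ (x j) :=
  Equiv.sum_comp (Tuple.sort fun j => -x j) fun j => φ (x j)

theorem sum_ite_lt {N l : ℕ} (hl : l ≤ N) (c : ℝ) :
    ∑ i : Fin N, (if (i : ℕ) < l then c else 0) = l * c := by
  rw [← Finset.sum_filter, Finset.sum_const, nsmul_eq_mul]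
  congr 2
  have : (Finset.univ.filter fun i : Fin N => (i : ℕ) < l).card = min N l := by
    simp [Fin.card_filter_val_lt]
  omega

theorem abs_topSum_sub_le {N l : ℕ} (hl : l ≤ N) {x y : Fin N → ℝ} {δ : ℝ}
    (h : ∀ j, |x j - y j| ≤ δ) : |topSum l x - topSum l y| ≤ l * δ := by
  rw [topSum, topSum, ← Finset.sum_sub_distrib, ← sum_ite_lt hl δ]
  refine (Finset.abs_sum_le_sum_abs _ _).trans (Finset.sum_le_sum fun i _ => ?_)
  split_ifs
  · exact abs_ranked_sub_le h i
  · simp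

/-- The objective `l λ + ∑ [x_j - λ]_+`, whose minimum over `λ` is `topSum l x`. -/
def hinge {N : ℕ} (l : ℕ) (x : Fin N → ℝ) (lam : ℝ) : ℝ := l * lam + ∑ j, max (x j - lam) 0

/-- The set of thresholds which separate the `l` largest coordinates from the others. -/
def thresholds {N : ℕ} (l : ℕ) (x : Fin N → ℝ) : Set ℝ :=
  {lam | ∀ i : Fin N, ((i : ℕ) < l → lam ≤ ranked x i) ∧ (l ≤ i → ranked x i ≤ lam)}

/-- After sorting, the coordinates decouple: one of the top `l` contributes `λ + [r - λ]_+ - r = [λ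
- r]_+`, any other `[r - λ]_+`. All terms are nonnegative, and they vanish together exactly at the
thresholds. -/
theorem hinge_sub_topSum {N l : ℕ} (hl : l ≤ N) (x : Fin N → ℝ) (lam : ℝ) :
    hinge l x lam - topSum l x = ∑ i : Fin N,
      if (i : ℕ) < l then max (lam - ranked x i) 0 else max (ranked x i - lam) 0 := by
  rw [hinge, topSum, ← sum_ranked x fun r => max (r - lam) 0, ← sum_ite_lt hl lam,
    ← Finset.sum_add_distrib, ← Finset.sum_sub_distrib]
  refine Finset.sum_congr rfl fun i _ => ?_
  split_ifs
  · rcases le_total (ranked x i) lam with h | h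
    · rw [max_eq_right (by linarith), max_eq_left (by linarith)]; ring
    · rw [max_eq_left (by linarith), max_eq_right (by linarith)]; ring
  · ring

theorem topSum_le_hinge {N l : ℕ} (hl : l ≤ N) (x : Fin N → ℝ) (lam : ℝ) :
    topSum l x ≤ hinge l x lam := by
  rw [← sub_nonneg, hinge_sub_topSum hl]
  refine Finset.sum_nonneg fun i _ => ?_
  split_ifs <;> exact le_max_right _ _

theorem hinge_eq_topSum {N l : ℕ} (hl : l ≤ N) {x : Fin N → ℝ} {lam : ℝ}
    (h : lam ∈ thresholds l x) : hinge l x lam = topSum l x := by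
  rw [← sub_eq_zero, hinge_sub_topSum hl]
  refine Finset.sum_eq_zero fun i _ => ?_
  split_ifs with hi
  · exact max_eq_right (sub_nonpos.2 ((h i).1 hi))
  · exact max_eq_right (sub_nonpos.2 ((h i).2 (not_lt.1 hi)))

/-- A value that is not a threshold is separated from the thresholds by a ranked coordinate. -/
theorem exists_threshold_of_notMem {N l : ℕ} {x : Fin N → ℝ} {lam : ℝ}
    (h : lam ∉ thresholds l x) :
    (∃ i : Fin N, (i : ℕ) < l ∧ ranked x i < lam ∧ ranked x i ∈ thresholds l x) ∨
      ∃ i : Fin N, l ≤ i ∧ lam < ranked x i ∧ ranked x i ∈ thresholds l x := by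
  simp only [thresholds, Set.mem_ofPred_eq, not_forall] at h
  obtain ⟨i, hi⟩ := h
  rw [not_and_or, Classical.not_imp, Classical.not_imp, not_le, not_le] at hi
  rcases hi with ⟨hil, hlt⟩ | ⟨hil, hlt⟩
  · left
    have hiN := i.2
    rcases le_or_gt l N with hlN | hlN
    · refine ⟨⟨l - 1, by omega⟩, by simp; omega, ?_, fun j => ⟨fun hj => ?_, fun hj => ?_⟩⟩
      · refine lt_of_le_of_lt (ranked_antitone x ?_) hlt
        rw [Fin.le_def]; simp; omega
      · apply ranked_antitone x
        rw [Fin.le_def]; simp; omega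
      · apply ranked_antitone x
        rw [Fin.le_def]; simp; omega
    · refine ⟨⟨N - 1, by omega⟩, by simp; omega, ?_, fun j => ⟨fun hj => ?_, fun hj => ?_⟩⟩
      · refine lt_of_le_of_lt (ranked_antitone x ?_) hlt
        rw [Fin.le_def]; simp; omega
      · apply ranked_antitone x
        rw [Fin.le_def]; simp; omega
      · have := j.2
        omega
  · right
    have hiN := i.2
    refine ⟨⟨l, by omega⟩, le_rfl, ?_, fun j => ⟨fun hj => ?_, fun hj => ?_⟩⟩
    · refine lt_of_lt_of_le hlt (ranked_antitone x ?_)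
      rw [Fin.le_def]; simpa using hil
    · apply ranked_antitone x
      rw [Fin.le_def]; simp; omega
    · apply ranked_antitone x
      rw [Fin.le_def]; simpa using hj

/-- Sharpness: the distance to the thresholds is at most the suboptimality. -/
theorem exists_threshold_le_hinge_sub {N l : ℕ} (hl : l ≤ N) (x : Fin N → ℝ) (lam : ℝ) :
    ∃ lam' ∈ thresholds l x, |lam - lam'| ≤ hinge l x lam - topSum l x := by
  by_cases h : lam ∈ thresholds l x
  · exact ⟨lam, h, by simpa using topSum_le_hinge hl x lam⟩
  have hnn : ∀ i : Fin N, 0 ≤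
      if (i : ℕ) < l then max (lam - ranked x i) 0 else max (ranked x i - lam) 0 := by
    intro i
    split_ifs <;> exact le_max_right _ _
  rcases exists_threshold_of_notMem h with ⟨i, hi, hlt, hm⟩ | ⟨i, hi, hlt, hm⟩
  · refine ⟨_, hm, ?_⟩
    rw [hinge_sub_topSum hl, abs_of_pos (sub_pos.2 hlt)]
    -- The single term of the violated coordinate already accounts for the whole distance: outside
    -- the thresholds the hinge objective grows with slope at least one.
    refine le_trans ?_ (Finset.single_le_sum (fun i _ => hnn i) (Finset.mem_univ i))
    rw [if_pos hi]
    exact le_max_left _ _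
  · refine ⟨_, hm, ?_⟩
    rw [hinge_sub_topSum hl, abs_sub_comm, abs_of_pos (sub_pos.2 hlt)]
    refine le_trans ?_ (Finset.single_le_sum (fun i _ => hnn i) (Finset.mem_univ i))
    rw [if_neg (not_lt.2 hi)]
    exact le_max_left _ _

theorem thresholds_nonempty {N l : ℕ} (hl : l ≤ N) (x : Fin N → ℝ) :
    (thresholds l x).Nonempty :=
  let ⟨lam, h, _⟩ := exists_threshold_le_hinge_sub hl x 0
  ⟨lam, h⟩

theorem isMinOn_hinge_iff {N l : ℕ} (hl : l ≤ N) {x : Fin N → ℝ} {lam : ℝ} :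
    IsMinOn (hinge l x) univ lam ↔ lam ∈ thresholds l x := by
  constructor
  · intro h
    obtain ⟨lam', hm, hle⟩ := exists_threshold_le_hinge_sub hl x lam
    have h1 : hinge l x lam ≤ hinge l x lam' := isMinOn_iff.1 h lam' (mem_univ _)
    rw [hinge_eq_topSum hl hm] at h1
    have h2 : lam - lam' = 0 := abs_nonpos_iff.1 (hle.trans (by linarith))
    rwa [sub_eq_zero.1 h2]
  · intro h
    refine isMinOn_iff.2 fun y _ => ?_
    rw [hinge_eq_topSum hl h]
    exact topSum_le_hinge hl x y

/-- The set of thresholds is Lipschitz in the coordinates. -/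
theorem exists_threshold_near {N l : ℕ} {x y : Fin N → ℝ} {δ lam : ℝ} (hδ : 0 ≤ δ)
    (h : ∀ j, |x j - y j| ≤ δ) (hlam : lam ∈ thresholds l x) :
    ∃ lam' ∈ thresholds l y, |lam - lam'| ≤ δ := by
  by_cases hy : lam ∈ thresholds l y
  · exact ⟨lam, hy, by simpa using hδ⟩
  rcases exists_threshold_of_notMem hy with ⟨i, hi, hlt, hm⟩ | ⟨i, hi, hlt, hm⟩
  · refine ⟨_, hm, ?_⟩
    rw [abs_of_pos (sub_pos.2 hlt)]
    linarith [(hlam i).1 hi, (abs_le.1 (abs_ranked_sub_le h i)).2]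
  · refine ⟨_, hm, ?_⟩
    rw [abs_sub_comm, abs_of_pos (sub_pos.2 hlt)]
    linarith [(hlam i).2 hi, (abs_le.1 (abs_ranked_sub_le h i)).1]

theorem isClosed_thresholds {N l : ℕ} (x : Fin N → ℝ) : IsClosed (thresholds l x) := by
  have : thresholds l x = ⋂ i : Fin N,
      ({lam | (i : ℕ) < l → lam ≤ ranked x i} ∩ {lam | l ≤ (i : ℕ) → ranked x i ≤ lam}) := by
    ext; simp [thresholds]
  rw [this]
  refine isClosed_iInter fun i => IsClosed.inter ?_ ?_
  · by_cases hi : (i : ℕ) < l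
    · simp only [hi, forall_true_left]; exact isClosed_Iic
    · simp [hi]
  · by_cases hi : l ≤ (i : ℕ)
    · simp only [hi, forall_true_left]; exact isClosed_Ici
    · simp [hi]

/-- The threshold set is convex. This is what lets the averaged `λ` of a run be compared with an
average of nearby optimal thresholds. -/
theorem average_mem_thresholds {N l T : ℕ} (hT : 0 < T) {x : Fin N → ℝ} {a : ℕ → ℝ}
    (ha : ∀ t, a t ∈ thresholds l x) :
    (T : ℝ)⁻¹ * ∑ t ∈ Finset.range T, a t ∈ thresholds l x := by
  have hT' : (0 : ℝ) < T := by exact_mod_cast hT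
  have hc : ∀ r : ℝ, r = (T : ℝ)⁻¹ * ∑ t ∈ Finset.range T, r := by
    intro r
    rw [Finset.sum_const, Finset.card_range, nsmul_eq_mul]
    field_simp
  intro i
  constructor
  · intro hi
    rw [hc (ranked x i)]
    gcongr with t _
    exact (ha t i).1 hi
  · intro hi
    rw [hc (ranked x i)]
    gcongr with t _
    exact (ha t i).2 hi

end SoRR

namespace SoRR

/-! ### Smooth functions -/

section Smooth

variable {d : ℕ} {s : E d → ℝ} {L B : ℝ}

theorem hasDerivAt_along (hs : Differentiable ℝ s) (v u : E d) (t : ℝ) :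
    HasDerivAt (fun t : ℝ => s (v + t • (u - v))) ⟪∇ s (v + t • (u - v)), u - v⟫ t := by
  have h1 : HasDerivAt (fun t : ℝ => v + t • (u - v)) (u - v) t := by
    simpa using ((hasDerivAt_id t).smul_const (u - v)).const_add v
  have h2 := (hs (v + t • (u - v))).hasGradientAt.hasFDerivAt
  have h3 := h2.comp_hasDerivAt t h1
  rw [InnerProductSpace.toDual_apply_apply] at h3
  exact h3

theorem smooth_lower_bound (hs : Differentiable ℝ s)
    (hL : ∀ w v, ‖∇ s w - ∇ s v‖ ≤ L * ‖w - v‖) (v u : E d) :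
    s v + ⟪∇ s v, u - v⟫ - L / 2 * ‖u - v‖ ^ 2 ≤ s u := by
  -- `φ` is the gap between `s` and its quadratic minorant along the segment; the Lipschitz gradient
  -- makes its derivative nonnegative for `t > 0`.
  set φ : ℝ → ℝ := fun t =>
    s (v + t • (u - v)) - t * ⟪∇ s v, u - v⟫ + L / 2 * ‖u - v‖ ^ 2 * t ^ 2 with hφ
  have hd : ∀ t, HasDerivAt φ (⟪∇ s (v + t • (u - v)), u - v⟫ - 1 * ⟪∇ s v, u - v⟫ +
      L / 2 * ‖u - v‖ ^ 2 * (2 * t)) t := by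
    intro t
    have h1 := (hasDerivAt_pow 2 t).const_mul (L / 2 * ‖u - v‖ ^ 2)
    simp only [Nat.cast_ofNat, Nat.add_one_sub_one, pow_one] at h1
    exact ((hasDerivAt_along hs v u t).sub ((hasDerivAt_id t).mul_const _)).add h1
  have hmono : MonotoneOn φ (Ici 0) := by
    refine monotoneOn_of_deriv_nonneg (convex_Ici 0)
      (fun t _ => (hd t).continuousAt.continuousWithinAt)
      (fun t _ => (hd t).differentiableAt.differentiableWithinAt) fun t ht => ?_
    rw [interior_Ici] at ht
    have ht0 : 0 < t := ht
    rw [(hd t).deriv]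
    have h1 : -(‖∇ s (v + t • (u - v)) - ∇ s v‖ * ‖u - v‖) ≤
        ⟪∇ s (v + t • (u - v)) - ∇ s v, u - v⟫ := neg_le_of_abs_le (abs_real_inner_le_norm _ _)
    have h2 := hL (v + t • (u - v)) v
    rw [add_sub_cancel_left, norm_smul, Real.norm_of_nonneg ht0.le] at h2
    have h3 := mul_le_mul_of_nonneg_right h2 (norm_nonneg (u - v))
    rw [inner_sub_left] at h1
    nlinarith
  have h := hmono (mem_Ici.2 le_rfl) (mem_Ici.2 zero_le_one) zero_le_one
  simp only [hφ, zero_smul, add_zero, one_smul, add_sub_cancel] at h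
  linarith

theorem abs_sub_le_of_norm_gradient_le (hs : Differentiable ℝ s) (hB : ∀ w, ‖∇ s w‖ ≤ B)
    (v u : E d) : |s u - s v| ≤ B * ‖u - v‖ := by
  have := Convex.norm_image_sub_le_of_norm_hasFDerivWithin_le (𝕜 := ℝ) (f := s) (C := B)
    (s := univ) (x := v) (y := u)
    (fun x _ => (hs x).hasGradientAt.hasFDerivAt.hasFDerivWithinAt)
    (fun x _ => (LinearIsometryEquiv.norm_map _ _).trans_le (hB x)) convex_univ (mem_univ _) (mem_univ _)
  simpa using this

end Smooth

/-! ### Weakly convex functions, proximal maps and Moreau envelopes -/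

/-- `f` is `ρ`-weakly convex. -/
def WeaklyConvex {d : ℕ} (ρ : ℝ) (f : E d → ℝ) : Prop :=
  ∀ (x y : E d) (t : ℝ), 0 ≤ t → t ≤ 1 →
    f ((1 - t) • x + t • y) ≤ (1 - t) * f x + t * f y + ρ / 2 * (t * (1 - t)) * ‖x - y‖ ^ 2

theorem norm_combination_sub_sq {d : ℕ} (x y w : E d) (t : ℝ) :
    ‖(1 - t) • x + t • y - w‖ ^ 2 =
      (1 - t) * ‖x - w‖ ^ 2 + t * ‖y - w‖ ^ 2 - t * (1 - t) * ‖x - y‖ ^ 2 := by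
  have h1 : (1 - t) • x + t • y - w = (1 - t) • (x - w) + t • (y - w) := by module
  have h2 : x - y = (x - w) - (y - w) := by abel
  rw [h1, h2]
  generalize x - w = a
  generalize y - w = b
  rw [norm_add_sq_real, norm_sub_sq_real, norm_smul, norm_smul, inner_smul_left, inner_smul_right,
    mul_pow, mul_pow, Real.norm_eq_abs, Real.norm_eq_abs, sq_abs, sq_abs]
  simp only [conj_trivial]
  ring

theorem weaklyConvex_of_smooth {d : ℕ} {s : E d → ℝ} {L : ℝ} (hs : Differentiable ℝ s)
    (hL : ∀ w v, ‖∇ s w - ∇ s v‖ ≤ L * ‖w - v‖) : WeaklyConvex L s := by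
  intro x y t ht0 ht1
  set z := (1 - t) • x + t • y with hz
  have hx := smooth_lower_bound hs hL z x
  have hy := smooth_lower_bound hs hL z y
  have e1 : x - z = t • (x - y) := by rw [hz]; module
  have e2 : y - z = (-(1 - t)) • (x - y) := by rw [hz]; module
  rw [e1, inner_smul_right, norm_smul, mul_pow, Real.norm_eq_abs, sq_abs] at hx
  rw [e2, inner_smul_right, norm_smul, mul_pow, Real.norm_eq_abs, sq_abs] at hy
  have h1 := mul_le_mul_of_nonneg_left hx (sub_nonneg.2 ht1)
  have h2 := mul_le_mul_of_nonneg_left hy ht0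
  linear_combination h1 + h2

/-- Lets `t → 0` after a minimizer has been compared with a point at fraction `t` along a segment
and a factor `t` cancelled. -/
theorem le_of_forall_mul_one_sub_le {a b : ℝ} (h : ∀ t : ℝ, 0 < t → t < 1 → (1 - t) * a ≤ b) :
    a ≤ b := by
  have h1 : Tendsto (fun t : ℝ => (1 - t) * a) (𝓝[>] 0) (𝓝 ((1 - 0) * a)) := by
    apply Tendsto.mono_left _ nhdsWithin_le_nhds
    exact Continuous.tendsto (by fun_prop) 0
  rw [sub_zero, one_mul] at h1
  refine le_of_tendsto h1 ?_
  filter_upwards [Ioo_mem_nhdsGT (show (0 : ℝ) < 1 by norm_num)] with t ht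
  exact h t ht.1 ht.2

/-- The Moreau envelope of `f`. -/
noncomputable def envelope {d : ℕ} (μ : ℝ) (f : E d → ℝ) (w : E d) : ℝ :=
  f (prox μ f w) + ‖prox μ f w - w‖ ^ 2 / (2 * μ)

section Prox

variable {d : ℕ} {f : E d → ℝ} {μ ρ C : ℝ}

/-- A Lipschitz function decreases at most linearly, so half of the quadratic term absorbs it and
the other half makes the objective coercive. Since `prox` is a choice, this existence gives it its
meaning. -/
theorem exists_isMinOn_prox_objective (hμ : 0 < μ) (hC : ∀ x y, |f x - f y| ≤ C * ‖x - y‖)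
    (w : E d) : ∃ v, IsMinOn (fun u => f u + ‖u - w‖ ^ 2 / (2 * μ)) univ v := by
  have hC0 : LipschitzWith C.toNNReal f := LipschitzWith.of_dist_le_mul fun x y => by
    rw [Real.dist_eq, dist_eq_norm]
    exact (hC x y).trans (mul_le_mul_of_nonneg_right (Real.le_coe_toNNReal C) (norm_nonneg _))
  have hcont : Continuous fun u => f u + ‖u - w‖ ^ 2 / (2 * μ) := by
    have := hC0.continuous
    fun_prop
  have hlow : ∀ u, f w - μ * C ^ 2 + ‖u - w‖ ^ 2 / (4 * μ) ≤ f u + ‖u - w‖ ^ 2 / (2 * μ) := by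
    intro u
    have h1 := (abs_le.1 (hC u w)).1
    have h2 : C * ‖u - w‖ ≤ μ * C ^ 2 + ‖u - w‖ ^ 2 / (4 * μ) := by
      have h3 : μ * C ^ 2 + ‖u - w‖ ^ 2 / (4 * μ) - C * ‖u - w‖ =
          (2 * μ * C - ‖u - w‖) ^ 2 / (4 * μ) := by field_simp; ring
      have h4 : 0 ≤ (2 * μ * C - ‖u - w‖) ^ 2 / (4 * μ) := by positivity
      linarith
    have h3 : ‖u - w‖ ^ 2 / (2 * μ) = ‖u - w‖ ^ 2 / (4 * μ) + ‖u - w‖ ^ 2 / (4 * μ) := by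
      field_simp; ring
    linarith
  have hlim : Tendsto (fun u => f u + ‖u - w‖ ^ 2 / (2 * μ)) (cocompact (E d)) atTop := by
    refine tendsto_atTop_mono hlow (tendsto_atTop_add_const_left _ _ ?_)
    refine Tendsto.atTop_div_const (by positivity) ((tendsto_pow_atTop two_ne_zero).comp ?_)
    refine tendsto_atTop_mono (fun u => ?_)
      (tendsto_atTop_add_const_right _ (-‖w‖) (tendsto_norm_cocompact_atTop (E := E d)))
    linarith [norm_sub_norm_le u w]
  obtain ⟨v, hv⟩ := hcont.exists_forall_le hlim
  exact ⟨v, isMinOn_iff.2 fun u _ => hv u⟩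

theorem prox_le (hμ : 0 < μ) (hC : ∀ x y, |f x - f y| ≤ C * ‖x - y‖) (w u : E d) :
    f (prox μ f w) + ‖prox μ f w - w‖ ^ 2 / (2 * μ) ≤ f u + ‖u - w‖ ^ 2 / (2 * μ) :=
  isMinOn_iff.1 (Classical.epsilon_spec (exists_isMinOn_prox_objective hμ hC w)) u (mem_univ u)

/-- Quadratic growth of the proximal objective around its minimizer. -/
theorem prox_growth (hμ : 0 < μ) (hC : ∀ x y, |f x - f y| ≤ C * ‖x - y‖)
    (hf : WeaklyConvex ρ f) (w u : E d) :
    f (prox μ f w) + ‖prox μ f w - w‖ ^ 2 / (2 * μ) + (1 / μ - ρ) / 2 * ‖u - prox μ f w‖ ^ 2 ≤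
      f u + ‖u - w‖ ^ 2 / (2 * μ) := by
  set p := prox μ f w
  suffices h : (1 / μ - ρ) / 2 * ‖u - p‖ ^ 2 ≤
      f u + ‖u - w‖ ^ 2 / (2 * μ) - (f p + ‖p - w‖ ^ 2 / (2 * μ)) by linarith
  -- The minimizer is compared with the point at fraction `t` towards `u`. The quadratic contributes
  -- `1/μ` to the strong convexity along this segment and `f` costs `ρ`.
  refine le_of_forall_mul_one_sub_le fun t ht0 ht1 => ?_
  have h1 := prox_le hμ hC w ((1 - t) • p + t • u)
  have h2 := hf p u t ht0.le ht1.le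
  rw [norm_combination_sub_sq] at h1
  have h3 : 0 ≤ t * (f u + ‖u - w‖ ^ 2 / (2 * μ) - (f p + ‖p - w‖ ^ 2 / (2 * μ)) -
      (1 - t) * ((1 / μ - ρ) / 2 * ‖u - p‖ ^ 2)) := by
    have h4 := h1.trans (add_le_add_left h2 _)
    rw [norm_sub_rev p u] at h4
    rw [← sub_nonneg] at h4
    refine h4.trans_eq ?_
    field_simp
    ring
  have h4 := nonneg_of_mul_nonneg_right h3 ht0
  linarith

/-- Sliding the proximal point slightly towards `w` compares the slope `C` of `f` with the slope `‖p
- w‖ / μ` of the quadratic. Comparing with `w` itself would lose a factor 2. -/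
theorem norm_prox_sub_le (hμ : 0 < μ) (hC : ∀ x y, |f x - f y| ≤ C * ‖x - y‖) (hC0 : 0 ≤ C)
    (w : E d) : ‖prox μ f w - w‖ ≤ μ * C := by
  set p := prox μ f w with hp
  by_contra! hlt
  have hpos : 0 < ‖p - w‖ := lt_of_le_of_lt (by positivity) hlt
  have h : ‖p - w‖ ≤ μ * C := by
    refine le_of_forall_mul_one_sub_le fun t ht0 ht1 => ?_
    have h1 := prox_le hμ hC w ((1 - t) • p + t • w)
    have h2 := (abs_le.1 (hC ((1 - t) • p + t • w) p)).2
    have e1 : (1 - t) • p + t • w - p = (-t) • (p - w) := by module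
    have e2 : (1 - t) • p + t • w - w = (1 - t) • (p - w) := by module
    rw [e1, norm_smul, norm_neg, Real.norm_of_nonneg ht0.le] at h2
    rw [e2, norm_smul, Real.norm_of_nonneg (by linarith), ← hp] at h1
    have h3 : (‖p - w‖ ^ 2 - ((1 - t) * ‖p - w‖) ^ 2) / (2 * μ) ≤ C * (t * ‖p - w‖) := by
      rw [sub_div]; linarith
    rw [div_le_iff₀ (by positivity)] at h3
    have h4 : (t * ‖p - w‖) * ((1 - t) * ‖p - w‖) ≤ (t * ‖p - w‖) * (μ * C) := by
      nlinarith [mul_nonneg (sq_nonneg t) (sq_nonneg ‖p - w‖)]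
    exact le_of_mul_le_mul_left h4 (by positivity)
  linarith

theorem norm_sub_sq_sub_norm_sub_sq {d : ℕ} (v w w' : E d) :
    ‖v - w'‖ ^ 2 - ‖v - w‖ ^ 2 = ‖w' - w‖ ^ 2 - 2 * ⟪v - w, w' - w⟫ := by
  rw [show v - w' = (v - w) - (w' - w) by abel, norm_sub_sq_real]
  ring

/-- Adding the two growth inequalities, each tested at the other proximal point, cancels `f` and
leaves `(1 - μρ) ‖p' - p‖² ≤ ⟪p' - p, w' - w⟫`. -/
theorem norm_prox_sub_prox_le (hμ : 0 < μ) (hC : ∀ x y, |f x - f y| ≤ C * ‖x - y‖)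
    (hf : WeaklyConvex ρ f) (hρ : ρ < 1 / μ) (w w' : E d) :
    ‖prox μ f w' - prox μ f w‖ ≤ ‖w' - w‖ / (1 - μ * ρ) := by
  have hμρ : 0 < 1 - μ * ρ := by
    rw [lt_div_iff₀ hμ] at hρ; linarith
  set p := prox μ f w
  set p' := prox μ f w'
  have h1 := prox_growth hμ hC hf w p'
  have h2 := prox_growth hμ hC hf w' p
  have h3 := norm_sub_sq_sub_norm_sub_sq p w w'
  have h4 := norm_sub_sq_sub_norm_sub_sq p' w w'
  rw [norm_sub_rev p p'] at h2
  have h5 : (1 - μ * ρ) * ‖p' - p‖ ^ 2 ≤ ⟪p' - p, w' - w⟫ := by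
    have h6 : (1 / μ - ρ) * ‖p' - p‖ ^ 2 ≤
        ((‖p' - w‖ ^ 2 - ‖p' - w'‖ ^ 2) + (‖p - w'‖ ^ 2 - ‖p - w‖ ^ 2)) / (2 * μ) := by
      rw [add_div, sub_div, sub_div]; linarith
    rw [le_div_iff₀ (by positivity)] at h6
    have h7 : ⟪p' - p, w' - w⟫ = ⟪p' - w, w' - w⟫ - ⟪p - w, w' - w⟫ := by
      rw [← inner_sub_left]; congr 1; abel
    have h8 : (1 / μ - ρ) * ‖p' - p‖ ^ 2 * (2 * μ) = 2 * ((1 - μ * ρ) * ‖p' - p‖ ^ 2) := by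
      field_simp
    linarith
  have h6 := real_inner_le_norm (p' - p) (w' - w)
  rw [le_div_iff₀ hμρ]
  rcases (norm_nonneg (p' - p)).eq_or_lt with h0 | h0
  · rw [← h0, zero_mul]; exact norm_nonneg _
  · refine le_of_mul_le_mul_left ?_ h0
    nlinarith

theorem smul_sub_prox_mem_subdiff (hμ : 0 < μ) (hC : ∀ x y, |f x - f y| ≤ C * ‖x - y‖)
    (w : E d) : μ⁻¹ • (w - prox μ f w) ∈ subdiff f (prox μ f w) := by
  set p := prox μ f w with hp
  intro c hc
  -- On this ball the quadratic error `‖v - p‖² / (2μ)` of the subgradient inequality is at most `c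
  -- ‖v - p‖`.
  have hball : Metric.ball p (2 * μ * c) ∈ 𝓝 p := Metric.ball_mem_nhds p (by positivity)
  filter_upwards [hball] with v hv
  rw [Metric.mem_ball, dist_eq_norm] at hv
  have h1 := prox_le hμ hC w v
  rw [← hp] at h1
  have h2 : ‖v - w‖ ^ 2 = ‖v - p‖ ^ 2 - 2 * ⟪w - p, v - p⟫ + ‖p - w‖ ^ 2 := by
    rw [show v - w = (v - p) - (w - p) by abel, norm_sub_sq_real, norm_sub_rev w p,
      real_inner_comm]
  rw [real_inner_smul_left]
  have h3 : ‖v - p‖ ^ 2 / (2 * μ) ≤ c * ‖v - p‖ := by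
    rw [div_le_iff₀ (by positivity)]
    nlinarith [norm_nonneg (v - p)]
  have h4 : ‖v - w‖ ^ 2 / (2 * μ) =
      ‖v - p‖ ^ 2 / (2 * μ) - μ⁻¹ * ⟪w - p, v - p⟫ + ‖p - w‖ ^ 2 / (2 * μ) := by
    rw [h2]; field_simp
  linarith

/-- The old proximal point is admissible at `w'`, so the upper curvature `1/μ` requires no weak
convexity. -/
theorem envelope_le (hμ : 0 < μ) (hC : ∀ x y, |f x - f y| ≤ C * ‖x - y‖) (w w' : E d) :
    envelope μ f w' ≤ envelope μ f w + μ⁻¹ * ⟪w - prox μ f w, w' - w⟫ +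
      ‖w' - w‖ ^ 2 / (2 * μ) := by
  have h1 := prox_le hμ hC w' (prox μ f w)
  have h2 := norm_sub_sq_sub_norm_sub_sq (prox μ f w) w w'
  have h3 : ⟪w - prox μ f w, w' - w⟫ = -⟪prox μ f w - w, w' - w⟫ := by
    rw [← inner_neg_left, neg_sub]
  have h4 : ‖prox μ f w - w'‖ ^ 2 / (2 * μ) = ‖prox μ f w - w‖ ^ 2 / (2 * μ) +
      μ⁻¹ * ⟪w - prox μ f w, w' - w⟫ + ‖w' - w‖ ^ 2 / (2 * μ) := by
    rw [h3, show ‖prox μ f w - w'‖ ^ 2 = ‖prox μ f w - w‖ ^ 2 + (‖w' - w‖ ^ 2 -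
      2 * ⟪prox μ f w - w, w' - w⟫) by linarith]
    field_simp
    ring
  unfold envelope
  linarith

/-- The new proximal point is tested in the growth inequality at `w`. Completing the square in `‖p'
- p‖` removes the unknown displacement, at the price of the stated curvature. -/
theorem le_envelope (hμ : 0 < μ) (hC : ∀ x y, |f x - f y| ≤ C * ‖x - y‖)
    (hf : WeaklyConvex ρ f) (hρ : ρ < 1 / μ) (w w' : E d) :
    envelope μ f w + μ⁻¹ * ⟪w - prox μ f w, w' - w⟫ -
      (1 / (μ * (1 - μ * ρ)) - 1 / μ) * ‖w' - w‖ ^ 2 / 2 ≤ envelope μ f w' := by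
  have hμρ : 0 < 1 - μ * ρ := by
    rw [lt_div_iff₀ hμ] at hρ; linarith
  set p := prox μ f w with hp
  set p' := prox μ f w' with hp'
  have h1 := prox_growth hμ hC hf w p'
  rw [← hp] at h1
  have h2 := norm_sub_sq_sub_norm_sub_sq p' w w'
  have h3 : ⟪p' - w, w' - w⟫ = ⟪p' - p, w' - w⟫ - ⟪w - p, w' - w⟫ := by
    rw [← inner_sub_left]; congr 1; abel
  have h4 := real_inner_le_norm (p' - p) (w' - w)
  have h5 : μ⁻¹ * (‖p' - p‖ * ‖w' - w‖) ≤ (1 / μ - ρ) / 2 * ‖p' - p‖ ^ 2 +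
      1 / (μ * (1 - μ * ρ)) * ‖w' - w‖ ^ 2 / 2 := by
    have h6 : (1 / μ - ρ) / 2 * ‖p' - p‖ ^ 2 + 1 / (μ * (1 - μ * ρ)) * ‖w' - w‖ ^ 2 / 2 -
        μ⁻¹ * (‖p' - p‖ * ‖w' - w‖) =
        ((1 - μ * ρ) * ‖p' - p‖ - ‖w' - w‖) ^ 2 / (2 * (μ * (1 - μ * ρ))) := by
      have := hμρ.ne'
      field_simp
      ring
    have h7 : 0 ≤ ((1 - μ * ρ) * ‖p' - p‖ - ‖w' - w‖) ^ 2 / (2 * (μ * (1 - μ * ρ))) := by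
      positivity
    linarith
  have h6 : ‖p' - w'‖ ^ 2 / (2 * μ) = ‖p' - w‖ ^ 2 / (2 * μ) + 1 / μ * ‖w' - w‖ ^ 2 / 2 -
      μ⁻¹ * ⟪p' - p, w' - w⟫ + μ⁻¹ * ⟪w - p, w' - w⟫ := by
    rw [show ‖p' - w'‖ ^ 2 = ‖p' - w‖ ^ 2 + (‖w' - w‖ ^ 2 - 2 * ⟪p' - w, w' - w⟫) by linarith, h3]
    field_simp
    ring
  have h7 : μ⁻¹ * ⟪p' - p, w' - w⟫ ≤ μ⁻¹ * (‖p' - p‖ * ‖w' - w‖) :=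
    mul_le_mul_of_nonneg_left h4 (by positivity)
  have h8 : (1 / (μ * (1 - μ * ρ)) - 1 / μ) * ‖w' - w‖ ^ 2 / 2 =
      1 / (μ * (1 - μ * ρ)) * ‖w' - w‖ ^ 2 / 2 - 1 / μ * ‖w' - w‖ ^ 2 / 2 := by ring
  unfold envelope
  rw [← hp, ← hp', h8]
  linarith

end Prox

end SoRR

namespace SoRR

/-! ### Regret of stochastic subgradient descent along a sample path -/

section Regret

variable {d N : ℕ} {s : Fin N → E d → ℝ} {J l : ℕ} {μ : ℝ} {A : ℕ → Finset (Fin N)}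
  {w u : E d} {lam lam' C M : ℝ}

/-- The step minimizes a strongly convex objective exactly, hence the two squared distances to the
new point on the left. The term in `1/μ` is kept because it later doubles the strong convexity
constant. -/
theorem proxStep_regret {η : ℝ} (hμ : 0 < μ) (hη : 0 < η) {G v : E d} (hG : ‖G‖ ≤ C) :
    ⟪G, v - u⟫ + ‖proxStep μ η w G v - w‖ ^ 2 / (2 * μ) - ‖u - w‖ ^ 2 / (2 * μ) +
        ‖u - proxStep μ η w G v‖ ^ 2 / (2 * μ) + ‖u - proxStep μ η w G v‖ ^ 2 / (2 * η) ≤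
      η * C ^ 2 / 2 + ‖u - v‖ ^ 2 / (2 * η) := by
  have h1 := proxStep_objective hμ hη w G v u
  set p := proxStep μ η w G v
  have h2 : ⟪G, v - u⟫ = ⟪G, v - p⟫ + ⟪G, p⟫ - ⟪G, u⟫ := by
    rw [inner_sub_right, inner_sub_right]; ring
  have h3 : ⟪G, v - p⟫ ≤ C * ‖p - v‖ := by
    rw [norm_sub_rev p v]
    exact (real_inner_le_norm _ _).trans (mul_le_mul_of_nonneg_right hG (norm_nonneg _))
  have h4 : C * ‖p - v‖ ≤ η * C ^ 2 / 2 + ‖p - v‖ ^ 2 / (2 * η) := by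
    have h5 : η * C ^ 2 / 2 + ‖p - v‖ ^ 2 / (2 * η) - C * ‖p - v‖ =
        (η * C - ‖p - v‖) ^ 2 / (2 * η) := by field_simp; ring
    have h6 : 0 ≤ (η * C - ‖p - v‖) ^ 2 / (2 * η) := by positivity
    linarith
  have h5 : (1 / (2 * μ) + 1 / (2 * η)) * ‖u - p‖ ^ 2 =
      ‖u - p‖ ^ 2 / (2 * μ) + ‖u - p‖ ^ 2 / (2 * η) := by ring
  linarith

/-- The one-step bound has its proximal terms at the new iterate, the claim has them at the old one.
The terminal terms carry this shift, and since the run starts at `w` it costs only the last term `‖u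
- w‖² / (2μ)`. -/
theorem sgdIter_regret_fst {η : ℝ} {θ : ℕ → ℝ} (hμ : 0 < μ) (hη : 0 < η)
    (hG : ∀ t v x, ‖gradV s J (A t) v x‖ ≤ C) (T : ℕ) :
    let z := sgdIter s J l μ (fun _ => η) θ A w lam
    ∑ t ∈ Finset.range T, (⟪gradV s J (A t) (z t).1 (z t).2, (z t).1 - u⟫ +
        ‖(z t).1 - w‖ ^ 2 / (2 * μ) - ‖u - w‖ ^ 2 / (2 * μ) + ‖u - (z t).1‖ ^ 2 / (2 * μ)) +
      ‖(z T).1 - w‖ ^ 2 / (2 * μ) + ‖u - (z T).1‖ ^ 2 / (2 * μ) + ‖u - (z T).1‖ ^ 2 / (2 * η) ≤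
    T * (η * C ^ 2 / 2) + ‖u - w‖ ^ 2 / (2 * η) + ‖u - w‖ ^ 2 / (2 * μ) := by
  intro z
  induction T with
  | zero => simp [z, sgdIter, add_comm]
  | succ T ih =>
    have h := proxStep_regret (w := w) (u := u) hμ hη (hG T (z T).1 (z T).2) (v := (z T).1)
    have hz : (z (T + 1)).1 = proxStep μ η w (gradV s J (A T) (z T).1 (z T).2) (z T).1 := rfl
    rw [← hz] at h
    rw [Finset.sum_range_succ]
    push_cast
    linarith

theorem sgdIter_regret_snd {η : ℕ → ℝ} {θ : ℝ} (hθ : 0 < θ)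
    (hG : ∀ t v x, |gradLam s J l (A t) v x| ≤ M) (T : ℕ) :
    let z := sgdIter s J l μ η (fun _ => θ) A w lam
    ∑ t ∈ Finset.range T, gradLam s J l (A t) (z t).1 (z t).2 * ((z t).2 - lam') +
      ((z T).2 - lam') ^ 2 / (2 * θ) ≤ T * (θ * M ^ 2 / 2) + (lam - lam') ^ 2 / (2 * θ) := by
  intro z
  induction T with
  | zero => simp [z, sgdIter]
  | succ T ih =>
    have hz : (z (T + 1)).2 = (z T).2 - θ * gradLam s J l (A T) (z T).1 (z T).2 := rfl
    have h := hG T (z T).1 (z T).2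
    rw [hz, Finset.sum_range_succ]
    generalize gradLam s J l (A T) (z T).1 (z T).2 = g at h
    have h1 : g ^ 2 ≤ M ^ 2 := sq_le_sq' (by linarith [(abs_le.1 h).1]) (abs_le.1 h).2
    have h2 : ((z T).2 - θ * g - lam') ^ 2 / (2 * θ) =
        ((z T).2 - lam') ^ 2 / (2 * θ) - g * ((z T).2 - lam') + θ * g ^ 2 / 2 := by
      field_simp; ring
    have h3 : θ * g ^ 2 / 2 ≤ θ * M ^ 2 / 2 := by gcongr
    rw [h2]
    push_cast
    linarith

theorem sgdIter_fst_of_eta_zero {θ : ℕ → ℝ} (hμ : 0 < μ) (t : ℕ) :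
    (sgdIter s J l μ (fun _ => 0) θ A w lam t).1 = w := by
  induction t with
  | zero => rfl
  | succ t ih => rw [sgdIter]; simp only [proxStep_zero hμ]; exact ih

theorem sgdIter_snd_of_theta_zero {η : ℕ → ℝ} (t : ℕ) :
    (sgdIter s J l μ η (fun _ => 0) A w lam t).2 = lam := by
  induction t with
  | zero => rfl
  | succ t ih => rw [sgdIter]; simpa using ih

/-- Step sizes proportional to the initial distances balance the two parts of each regret bound and
make the result linear in those distances. -/
theorem sgdIter_regret (hμ : 0 < μ) (hC : 0 < C) (hM : 0 < M)
    (hGv : ∀ t v x, ‖gradV s J (A t) v x‖ ≤ C)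
    (hGl : ∀ t v x, |gradLam s J l (A t) v x| ≤ M) {T : ℕ} (hT : 0 < T) {η θ : ℝ}
    (hη : η = ‖u - w‖ / (C * √T)) (hθ : θ = |lam - lam'| / (√T * M)) :
    let z := sgdIter s J l μ (fun _ => η) (fun _ => θ) A w lam
    ∑ t ∈ Finset.range T, (⟪gradV s J (A t) (z t).1 (z t).2, (z t).1 - u⟫ +
        gradLam s J l (A t) (z t).1 (z t).2 * ((z t).2 - lam') +
        ‖(z t).1 - w‖ ^ 2 / (2 * μ) - ‖u - w‖ ^ 2 / (2 * μ) + ‖u - (z t).1‖ ^ 2 / (2 * μ)) ≤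
      √T * (C * ‖u - w‖ + M * |lam - lam'|) + ‖u - w‖ ^ 2 / (2 * μ) := by
  intro z
  have hT0 : (0 : ℝ) < T := by exact_mod_cast hT
  have hsT : 0 < √(T : ℝ) := Real.sqrt_pos.2 hT0
  have hsq : √(T : ℝ) ^ 2 = T := Real.sq_sqrt hT0.le
  have h1 : ∑ t ∈ Finset.range T, (⟪gradV s J (A t) (z t).1 (z t).2, (z t).1 - u⟫ +
        ‖(z t).1 - w‖ ^ 2 / (2 * μ) - ‖u - w‖ ^ 2 / (2 * μ) + ‖u - (z t).1‖ ^ 2 / (2 * μ)) ≤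
      √T * (C * ‖u - w‖) + ‖u - w‖ ^ 2 / (2 * μ) := by
    -- At distance zero the step size is zero and the regret bound, which divides by it, is
    -- unavailable; but then the iterates never leave the optimum.
    rcases (norm_nonneg (u - w)).eq_or_lt with h0 | h0
    · have hη0 : η = 0 := by rw [hη, ← h0, zero_div]
      have huw : u = w := sub_eq_zero.1 (norm_eq_zero.1 h0.symm)
      have hz : ∀ t, (z t).1 = w := by
        intro t
        simp only [z, hη0]
        exact sgdIter_fst_of_eta_zero hμ t
      simp [hz, huw]
    · have hηp : 0 < η := by rw [hη]; positivity
      have h := sgdIter_regret_fst (l := l) (w := w) (u := u) (lam := lam) (θ := fun _ => θ)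
        hμ hηp hGv T
      have e1 : (T : ℝ) * (η * C ^ 2 / 2) + ‖u - w‖ ^ 2 / (2 * η) = √T * (C * ‖u - w‖) := by
        rw [hη]; field_simp; linarith
      have p1 : 0 ≤ ‖(z T).1 - w‖ ^ 2 / (2 * μ) := by positivity
      have p2 : 0 ≤ ‖u - (z T).1‖ ^ 2 / (2 * μ) := by positivity
      have p3 : 0 ≤ ‖u - (z T).1‖ ^ 2 / (2 * η) := by positivity
      simp only [z] at p1 p2 p3 ⊢
      linarith
  have h2 : ∑ t ∈ Finset.range T, gradLam s J l (A t) (z t).1 (z t).2 * ((z t).2 - lam') ≤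
      √T * (M * |lam - lam'|) := by
    rcases (abs_nonneg (lam - lam')).eq_or_lt with h0 | h0
    · have hθ0 : θ = 0 := by rw [hθ, ← h0, zero_div]
      have hll : lam = lam' := sub_eq_zero.1 (abs_eq_zero.1 h0.symm)
      have hz : ∀ t, (z t).2 = lam' := by
        intro t
        simp only [z, hθ0, ← hll]
        exact sgdIter_snd_of_theta_zero t
      simp [hz, hll]
    · have hθp : 0 < θ := by rw [hθ]; positivity
      have h := sgdIter_regret_snd (μ := μ) (w := w) (lam := lam) (lam' := lam')
        (η := fun _ => η) hθp hGl T
      have e1 : (T : ℝ) * (θ * M ^ 2 / 2) + (lam - lam') ^ 2 / (2 * θ) =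
          √T * (M * |lam - lam'|) := by
        rw [hθ, ← sq_abs (lam - lam')]; field_simp; linarith
      have p1 : 0 ≤ ((z T).2 - lam') ^ 2 / (2 * θ) := by positivity
      simp only [z] at p1 ⊢
      linarith
  have h3 : ∑ t ∈ Finset.range T, (⟪gradV s J (A t) (z t).1 (z t).2, (z t).1 - u⟫ +
        gradLam s J l (A t) (z t).1 (z t).2 * ((z t).2 - lam') +
        ‖(z t).1 - w‖ ^ 2 / (2 * μ) - ‖u - w‖ ^ 2 / (2 * μ) + ‖u - (z t).1‖ ^ 2 / (2 * μ)) =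
      ∑ t ∈ Finset.range T, (⟪gradV s J (A t) (z t).1 (z t).2, (z t).1 - u⟫ +
        ‖(z t).1 - w‖ ^ 2 / (2 * μ) - ‖u - w‖ ^ 2 / (2 * μ) + ‖u - (z t).1‖ ^ 2 / (2 * μ)) +
      ∑ t ∈ Finset.range T, gradLam s J l (A t) (z t).1 (z t).2 * ((z t).2 - lam') := by
    rw [← Finset.sum_add_distrib]
    exact Finset.sum_congr rfl fun t _ => by ring
  rw [h3]
  linarith

end Regret

/-! ### Stochastic subgradients -/

section Subgradient

variable {d N : ℕ} {s : Fin N → E d → ℝ} {J l : ℕ} {L B : ℝ}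

theorem norm_gradV_le (hJ : 1 ≤ J) (hB : 0 ≤ B) (hgrad : ∀ j w, ‖∇ (s j) w‖ ≤ B)
    {a : Finset (Fin N)} (ha : a.card = J) (v : E d) (lam : ℝ) :
    ‖gradV s J a v lam‖ ≤ N * B := by
  have hJ0 : (0 : ℝ) < J := by exact_mod_cast hJ
  rw [gradV, norm_smul, Real.norm_of_nonneg (by positivity)]
  have h : ‖∑ j ∈ a, if lam < s j v then ∇ (s j) v else 0‖ ≤ J * B := by
    refine (norm_sum_le _ _).trans ?_
    rw [← ha, ← nsmul_eq_mul]
    refine Finset.sum_le_card_nsmul _ _ _ fun j _ => ?_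
    split_ifs
    · exact hgrad j v
    · simpa using hB
  calc (N : ℝ) / J * _ ≤ N / J * (J * B) := by gcongr
    _ = N * B := by field_simp

theorem abs_gradLam_le (hJ : 1 ≤ J) (hl : l ≤ N) {a : Finset (Fin N)} (ha : a.card = J) (v : E d)
    (lam : ℝ) : |gradLam s J l a v lam| ≤ N := by
  have hJ0 : (0 : ℝ) < J := by exact_mod_cast hJ
  have hl' : (l : ℝ) ≤ N := by exact_mod_cast hl
  have h0 : 0 ≤ ∑ j ∈ a, if lam < s j v then (1 : ℝ) else 0 :=
    Finset.sum_nonneg fun j _ => by split_ifs <;> norm_num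
  have h1 : ∑ j ∈ a, (if lam < s j v then (1 : ℝ) else 0) ≤ J := by
    rw [← ha, ← mul_one (a.card : ℝ), ← nsmul_eq_mul]
    exact Finset.sum_le_card_nsmul _ _ _ fun j _ => by split_ifs <;> norm_num
  have h2 : (N : ℝ) / J * ∑ j ∈ a, (if lam < s j v then (1 : ℝ) else 0) ≤ N := by
    calc (N : ℝ) / J * _ ≤ N / J * J := by gcongr
      _ = N := by field_simp
  have h3 : 0 ≤ (N : ℝ) / J * ∑ j ∈ a, (if lam < s j v then (1 : ℝ) else 0) := by positivity
  rw [gradLam, abs_le]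
  have := (Nat.cast_nonneg l : (0 : ℝ) ≤ l)
  constructor <;> linarith

/-- The contribution of one component to the linearization of the hinge objective. -/
noncomputable def linTerm (s : Fin N → E d → ℝ) (u : E d) (lam' : ℝ) (v : E d) (lam : ℝ)
    (j : Fin N) : ℝ :=
  if lam < s j v then ⟪∇ (s j) v, v - u⟫ - (lam - lam') else 0

theorem inner_gradV_add_gradLam (a : Finset (Fin N)) (u v : E d) (lam lam' : ℝ) :
    ⟪gradV s J a v lam, v - u⟫ + gradLam s J l a v lam * (lam - lam') =
      l * (lam - lam') + (N / J) * ∑ j ∈ a, linTerm s u lam' v lam j := by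
  rw [gradV, gradLam, real_inner_smul_left, sum_inner, sub_mul, mul_assoc, Finset.sum_mul,
    add_sub_left_comm, ← mul_sub, ← Finset.sum_sub_distrib]
  congr 2
  refine Finset.sum_congr rfl fun j _ => ?_
  unfold linTerm
  split_ifs <;> simp

/-- Unbiasedness of subset sampling: each index lies in `(N-1).choose (J-1)` of the `N.choose J`
subsets, a proportion `J / N`. -/
theorem average_powersetCard (hJ : 1 ≤ J) (hJN : J ≤ N) (c : Fin N → ℝ) :
    ((N.choose J : ℕ) : ℝ)⁻¹ * ∑ a ∈ Finset.powersetCard J (Finset.univ : Finset (Fin N)),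
      ((N : ℝ) / J) * ∑ j ∈ a, c j = ∑ j, c j := by
  classical
  have h1 : ∑ a ∈ Finset.powersetCard J (Finset.univ : Finset (Fin N)), ∑ j ∈ a, c j =
      ((N - 1).choose (J - 1) : ℕ) * ∑ j, c j := by
    have h2 : ∀ a : Finset (Fin N), ∑ j ∈ a, c j = ∑ j, if j ∈ a then c j else 0 := by
      intro a
      simp
    rw [Finset.sum_congr rfl fun a _ => h2 a, Finset.sum_comm, Finset.mul_sum]
    refine Finset.sum_congr rfl fun j _ => ?_
    rw [← Finset.sum_filter, Finset.sum_const, nsmul_eq_mul]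
    congr 2
    have h3 := Finset.card_filter_powersetCard_subset {j} (Finset.univ : Finset (Fin N)) J
      (Finset.subset_univ _) (by simpa using hJ)
    simpa using h3
  have h4 : N * (N - 1).choose (J - 1) = N.choose J * J := by
    obtain ⟨N, rfl⟩ : ∃ k, N = k + 1 := ⟨N - 1, by omega⟩
    obtain ⟨J, rfl⟩ : ∃ k, J = k + 1 := ⟨J - 1, by omega⟩
    simpa using Nat.add_one_mul_choose_eq N J
  have h5 : (N : ℝ) * ((N - 1).choose (J - 1) : ℕ) = (N.choose J : ℕ) * J := by exact_mod_cast h4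
  have hJ0 : (0 : ℝ) < J := by exact_mod_cast hJ
  have hc : (0 : ℝ) < (N.choose J : ℕ) := by exact_mod_cast Nat.choose_pos hJN
  rw [← Finset.mul_sum, h1]
  field_simp
  rw [h5]

/-- Componentwise subgradient inequality: an active positive part is bounded below through the
smoothness of `s j`, an inactive one through nonnegativity. Each component loses at most `L/2 ‖u -
v‖²`. -/
theorem hinge_linearization (hdiff : ∀ j, Differentiable ℝ (s j))
    (hL : ∀ j w v, ‖∇ (s j) w - ∇ (s j) v‖ ≤ L * ‖w - v‖) (hL0 : 0 ≤ L) (u v : E d)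
    (lam lam' : ℝ) :
    hinge l (fun j => s j v) lam - hinge l (fun j => s j u) lam' - N * L / 2 * ‖u - v‖ ^ 2 ≤
      l * (lam - lam') + ∑ j, linTerm s u lam' v lam j := by
  have h1 : ∀ j, max (s j v - lam) 0 - max (s j u - lam') 0 - L / 2 * ‖u - v‖ ^ 2 ≤
      linTerm s u lam' v lam j := by
    intro j
    have h2 := smooth_lower_bound (hdiff j) (hL j) v u
    have h3 : ⟪∇ (s j) v, v - u⟫ = -⟪∇ (s j) v, u - v⟫ := by rw [← inner_neg_right, neg_sub]
    have h4 : 0 ≤ L / 2 * ‖u - v‖ ^ 2 := by positivity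
    unfold linTerm
    split_ifs with h
    · rw [max_eq_left (by linarith)]
      have := le_max_left (s j u - lam') 0
      linarith
    · rw [max_eq_right (by linarith)]
      have := le_max_right (s j u - lam') 0
      linarith
  have h2 := Finset.sum_le_sum fun j (_ : j ∈ Finset.univ) => h1 j
  rw [Finset.sum_sub_distrib, Finset.sum_sub_distrib, Finset.sum_const, Finset.card_univ,
    Fintype.card_fin, nsmul_eq_mul] at h2
  unfold hinge
  linarith

end Subgradient

end SoRR

/-! ### Deterministic estimates for one inner run -/

namespace SoRR

variable {d N : ℕ}

/-- The standing assumptions on the problem and on the parameters. -/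
structure Setup.Regular (S : Setup d N) : Prop where
  m_lt_n : S.m < S.n
  n_le : S.n ≤ N
  one_le_J : 1 ≤ S.J
  J_le : S.J ≤ N
  diff : ∀ j, Differentiable ℝ (S.s j)
  L_nonneg : 0 ≤ S.L
  smooth : ∀ j w v, ‖∇ (S.s j) w - ∇ (S.s j) v‖ ≤ S.L * ‖w - v‖
  B_pos : 0 < S.B
  norm_grad_le : ∀ j w, ‖∇ (S.s j) w‖ ≤ S.B
  bddBelow : BddBelow (range S.F)
  μ_pos : 0 < S.μ
  ρ_lt_inv : S.ρ < S.μ⁻¹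
  γ_pos : 0 < S.γ
  γ_le : S.γ ≤ 1 / S.Lμ

namespace Setup

/-- The modulus of strong convexity of the proximal objectives. -/
noncomputable def τ (S : Setup d N) : ℝ := S.μ⁻¹ - S.ρ

/-- A projection of `lam` onto the set of optimal thresholds. -/
noncomputable def lamProj (S : Setup d N) (l : ℕ) (w : E d) (lam : ℝ) : ℝ :=
  Classical.epsilon fun x =>
    x ∈ S.LambdaStar l w ∧ Metric.infDist lam (S.LambdaStar l w) = |lam - x|

/-- The iterates of the inner run `b` of outer iteration `k`. -/
noncomputable def iter (S : Setup d N) (A : ℕ → Bool → ℕ → Finset (Fin N)) (k : ℕ) (b : Bool)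
    (w : E d) (lam : ℝ) (t : ℕ) : E d × ℝ :=
  sgdIter S.s S.J (S.level b) S.μ (fun _ => S.η k b w) (fun _ => S.θ k b w lam) (A k b) w lam t

/-- The linearized stochastic suboptimality at `z` for the sample `a`. -/
noncomputable def stepTerm (S : Setup d N) (l : ℕ) (w : E d) (lam : ℝ) (z : E d × ℝ)
    (a : Finset (Fin N)) : ℝ :=
  ⟪gradV S.s S.J a z.1 z.2, z.1 - S.proxF l w⟫ +
    gradLam S.s S.J l a z.1 z.2 * (z.2 - S.lamProj l w lam)

/-- The difference of the proximal terms at `v` and at the proximal point, plus the squared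
distance of `v` to it. -/
noncomputable def proxTerm (S : Setup d N) (l : ℕ) (w v : E d) : ℝ :=
  ‖v - w‖ ^ 2 / (2 * S.μ) - ‖S.proxF l w - w‖ ^ 2 / (2 * S.μ) +
    ‖S.proxF l w - v‖ ^ 2 / (2 * S.μ)

/-- The suboptimality of the threshold. -/
noncomputable def gap (S : Setup d N) (l : ℕ) (z : E d × ℝ) : ℝ := S.g l z.1 z.2 - S.f l z.1

namespace Regular

variable {S : Setup d N} (R : S.Regular)
include R

theorem N_pos : 0 < N := lt_of_lt_of_le (Nat.zero_lt_of_lt R.m_lt_n) R.n_le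

theorem N_one_le : (1 : ℝ) ≤ N := by exact_mod_cast R.N_pos

theorem level_le (b : Bool) : S.level b ≤ N := by
  have := R.m_lt_n.le.trans R.n_le
  cases b
  · simpa [level]
  · simpa [level] using R.n_le

theorem τ_pos : 0 < S.τ := sub_pos.2 R.ρ_lt_inv

theorem ρ_lt : S.ρ < 1 / S.μ := by simpa using R.ρ_lt_inv

theorem one_sub_pos : 0 < 1 - S.μ * S.ρ := by
  have := (lt_div_iff₀ R.μ_pos).1 R.ρ_lt
  linarith

theorem abs_s_sub_le (j : Fin N) (x y : E d) : |S.s j x - S.s j y| ≤ S.B * ‖x - y‖ :=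
  abs_sub_le_of_norm_gradient_le (R.diff j) (R.norm_grad_le j) y x

theorem abs_f_sub_le {l : ℕ} (hl : l ≤ N) (x y : E d) :
    |S.f l x - S.f l y| ≤ l * S.B * ‖x - y‖ := by
  rw [mul_assoc]
  exact abs_topSum_sub_le hl fun j => R.abs_s_sub_le j x y

/-- Partial minimization: the hinge objective is jointly weakly convex in `(v, λ)`. Optimal
thresholds at `x` and `y` are combined with the same weights and tested at the intermediate point.
-/
theorem weaklyConvex_f {l : ℕ} (hl : l ≤ N) : WeaklyConvex S.ρ (S.f l) := by
  intro x y t ht0 ht1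
  obtain ⟨a, ha⟩ := thresholds_nonempty hl fun j => S.s j x
  obtain ⟨b, hb⟩ := thresholds_nonempty hl fun j => S.s j y
  have h1 := topSum_le_hinge hl (fun j => S.s j ((1 - t) • x + t • y)) ((1 - t) * a + t * b)
  have h2 := hinge_eq_topSum hl ha
  have h3 := hinge_eq_topSum hl hb
  have ht1' := sub_nonneg.2 ht1
  have h4 : ∀ j, max (S.s j ((1 - t) • x + t • y) - ((1 - t) * a + t * b)) 0 ≤
      (1 - t) * max (S.s j x - a) 0 + t * max (S.s j y - b) 0 +
        S.L / 2 * (t * (1 - t)) * ‖x - y‖ ^ 2 := by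
    intro j
    have h5 := weaklyConvex_of_smooth (R.diff j) (R.smooth j) x y t ht0 ht1
    have h6 := mul_le_mul_of_nonneg_left (le_max_left (S.s j x - a) 0) ht1'
    have h7 := mul_le_mul_of_nonneg_left (le_max_left (S.s j y - b) 0) ht0
    have h8 := R.L_nonneg
    apply max_le
    · linarith
    · have := le_max_right (S.s j x - a) 0
      have := le_max_right (S.s j y - b) 0
      positivity
  have h5 := Finset.sum_le_sum fun j (_ : j ∈ Finset.univ) => h4 j
  rw [Finset.sum_add_distrib, Finset.sum_add_distrib, Finset.sum_const, Finset.card_univ,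
    Fintype.card_fin, nsmul_eq_mul, ← Finset.mul_sum, ← Finset.mul_sum] at h5
  unfold f ρ
  rw [← h2, ← h3]
  refine h1.trans ?_
  unfold hinge
  linarith

theorem norm_proxF_sub_le {l : ℕ} (hl : l ≤ N) (w : E d) :
    ‖S.proxF l w - w‖ ≤ S.μ * (l * S.B) :=
  norm_prox_sub_le R.μ_pos (R.abs_f_sub_le hl) (mul_nonneg (Nat.cast_nonneg _) R.B_pos.le) w

theorem norm_proxF_sub_proxF_le {l : ℕ} (hl : l ≤ N) (w w' : E d) :
    ‖S.proxF l w' - S.proxF l w‖ ≤ ‖w' - w‖ / (1 - S.μ * S.ρ) :=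
  norm_prox_sub_prox_le R.μ_pos (R.abs_f_sub_le hl) (R.weaklyConvex_f hl) R.ρ_lt w w'

omit R in
theorem LambdaStar_eq {l : ℕ} (hl : l ≤ N) (w : E d) :
    S.LambdaStar l w = thresholds l fun j => S.s j (S.proxF l w) :=
  Set.ext fun _ => isMinOn_hinge_iff hl

omit R in
theorem LambdaStar_nonempty {l : ℕ} (hl : l ≤ N) (w : E d) : (S.LambdaStar l w).Nonempty :=
  LambdaStar_eq (S := S) hl w ▸ thresholds_nonempty hl _

omit R in
theorem lamProj_spec {l : ℕ} (hl : l ≤ N) (w : E d) (lam : ℝ) :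
    S.lamProj l w lam ∈ S.LambdaStar l w ∧
      Metric.infDist lam (S.LambdaStar l w) = |lam - S.lamProj l w lam| := by
  refine Classical.epsilon_spec (p := fun x =>
    x ∈ S.LambdaStar l w ∧ Metric.infDist lam (S.LambdaStar l w) = |lam - x|) ?_
  have hcl : IsClosed (S.LambdaStar l w) := LambdaStar_eq (S := S) hl w ▸ isClosed_thresholds _
  exact hcl.exists_infDist_eq_dist (LambdaStar_nonempty hl w) lam

omit R in
theorem gap_nonneg {l : ℕ} (hl : l ≤ N) (z : E d × ℝ) : 0 ≤ S.gap l z :=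
  sub_nonneg.2 (topSum_le_hinge hl _ _)

/-- The distance of a threshold to the optimal ones in terms of its suboptimality. -/
theorem exists_mem_LambdaStar {l : ℕ} (hl : l ≤ N) (w : E d) (z : E d × ℝ) :
    ∃ x ∈ S.LambdaStar l w, |z.2 - x| ≤ S.gap l z + S.B * ‖z.1 - S.proxF l w‖ := by
  -- Sharpness leads to a threshold for the iterate's own `v`; Lipschitz dependence then carries it
  -- to one for the proximal point.
  obtain ⟨x, hx, h1⟩ := exists_threshold_le_hinge_sub hl (fun j => S.s j z.1) z.2
  obtain ⟨y, hy, h2⟩ := exists_threshold_near (mul_nonneg R.B_pos.le (norm_nonneg _))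
    (fun j => R.abs_s_sub_le j z.1 (S.proxF l w)) hx
  rw [LambdaStar_eq hl]
  refine ⟨y, hy, ?_⟩
  calc |z.2 - y| ≤ |z.2 - x| + |x - y| := abs_sub_le _ _ _
    _ ≤ _ := add_le_add h1 h2

theorem infDist_LambdaStar_le {l : ℕ} (hl : l ≤ N) (w w' : E d) (lam : ℝ) :
    Metric.infDist lam (S.LambdaStar l w') ≤
      Metric.infDist lam (S.LambdaStar l w) + S.B / (1 - S.μ * S.ρ) * ‖w' - w‖ := by
  obtain ⟨h1, h2⟩ := lamProj_spec (S := S) hl w lam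
  rw [h2]
  rw [LambdaStar_eq hl] at h1
  obtain ⟨y, hy, h3⟩ := exists_threshold_near (mul_nonneg R.B_pos.le (norm_nonneg _))
    (fun j => R.abs_s_sub_le j (S.proxF l w) (S.proxF l w')) h1
  rw [← LambdaStar_eq hl] at hy
  have h4 := R.norm_proxF_sub_proxF_le hl w w'
  rw [norm_sub_rev] at h3
  have h5 := mul_le_mul_of_nonneg_left h4 R.B_pos.le
  have h6 : S.B * (‖w' - w‖ / (1 - S.μ * S.ρ)) = S.B / (1 - S.μ * S.ρ) * ‖w' - w‖ := by ring
  calc Metric.infDist lam (S.LambdaStar l w') ≤ |lam - y| := Metric.infDist_le_dist_of_mem hy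
    _ ≤ |lam - S.lamProj l w lam| + |S.lamProj l w lam - y| := abs_sub_le _ _ _
    _ ≤ _ := by linarith

omit R in
theorem D_ge (b : Bool) :
    S.τ / 2 + S.μ * (S.level b) ^ 2 * S.B ^ 2 / 2 + S.B +
      S.B / (1 - S.μ * S.ρ) * (2 * S.γ / S.μ + S.γ * S.n * S.B + S.γ * S.m * S.B) ≤ S.D b := by
  have := le_max_right (Metric.infDist (S.lam₀ b) (S.LambdaStar (S.level b) S.w₀))
    (1 / 2 * (1 / S.μ - S.ρ) + S.μ * (S.level b) ^ 2 * S.B ^ 2 / 2 + S.B +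
      S.B / (1 - S.μ * S.ρ) * (2 * S.γ / S.μ + S.γ * S.n * S.B + S.γ * S.m * S.B))
  unfold D τ
  rw [one_div S.μ] at this ⊢
  linarith

theorem D_ge' (b : Bool) :
    S.τ / 2 + S.μ * (S.level b) ^ 2 * S.B ^ 2 / 2 ≤ S.D b := by
  have h1 := D_ge (S := S) b
  have h2 := R.B_pos
  have h3 := R.one_sub_pos
  have h4 := R.γ_pos
  have h5 := R.μ_pos
  have : 0 ≤ S.B / (1 - S.μ * S.ρ) * (2 * S.γ / S.μ + S.γ * S.n * S.B + S.γ * S.m * S.B) := by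
    positivity
  linarith

theorem D_pos (b : Bool) : 0 < S.D b := by
  have h1 := R.D_ge' b
  have h2 := R.τ_pos
  have h5 := R.μ_pos
  have : 0 ≤ S.μ * (S.level b : ℝ) ^ 2 * S.B ^ 2 / 2 := by positivity
  linarith

omit R in
theorem le_T (k : ℕ) (b : Bool) :
    144 * (N : ℝ) ^ 2 * S.D b ^ 2 * (k + 1) ^ 2 / S.τ ^ 2 ≤ S.T k b :=
  (le_max_left _ _).trans ((le_max_left _ _).trans (Nat.le_ceil _))

theorem T_pos (k : ℕ) (b : Bool) : 0 < S.T k b := by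
  have h1 := le_T (S := S) k b
  have h2 := R.D_pos b
  have h3 := R.τ_pos
  have h4 : (0 : ℝ) < N := by exact_mod_cast R.N_pos
  have h5 : 0 < 144 * (N : ℝ) ^ 2 * S.D b ^ 2 * (k + 1) ^ 2 / S.τ ^ 2 := by positivity
  exact_mod_cast h5.trans_le h1

/-- The budget `T τ / (2(k+1))` is halved between the `√T` term and the remaining constant, both
controlled by the bound `√T ≥ 12 N D (k+1) / τ`. -/
theorem regret_bound_le (k : ℕ) (b : Bool) {a δ : ℝ} (ha0 : 0 ≤ a)
    (ha : a ≤ S.μ * (S.level b * S.B)) (hδ : δ ≤ S.D b) :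
    √(S.T k b) * (N * S.B * a + N * δ) + a ^ 2 / (2 * S.μ) ≤
      S.T k b * (S.τ / (2 * (k + 1))) := by
  have hN := R.N_one_le
  have hD := R.D_pos b
  have hτ := R.τ_pos
  have hB := R.B_pos
  have hμ := R.μ_pos
  have hT := le_T (S := S) k b
  have hT0 : (0 : ℝ) < S.T k b := by exact_mod_cast R.T_pos k b
  have hD' := R.D_ge' b
  have hk : (1 : ℝ) ≤ k + 1 := by
    have : (0 : ℝ) ≤ k := Nat.cast_nonneg k
    linarith
  set l : ℝ := (S.level b : ℝ) with hl
  have hl0 : 0 ≤ l := Nat.cast_nonneg _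
  -- Integrality of the rank: the regret produces `μ l B²` while `D` contains `μ l² B² / 2`, so `B a
  -- ≤ 2D`, and with `δ ≤ D` the total is `3D`.
  have hll : l ≤ l ^ 2 := by
    rw [hl]; exact_mod_cast Nat.le_self_pow two_ne_zero _
  set T : ℝ := ((S.T k b : ℕ) : ℝ)
  set K : ℝ := (k : ℝ) + 1
  set D := S.D b
  have hK0 : 0 < K := by linarith
  have h1 : 12 * N * D * K / S.τ ≤ √T := by
    apply Real.le_sqrt_of_sq_le
    refine le_of_eq_of_le ?_ hT
    ring
  have h2 : N * S.B * a + N * δ ≤ 3 * (N * D) := by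
    have e1 : S.B * a ≤ S.B * (S.μ * (l * S.B)) := by gcongr
    have e2 : S.μ * S.B ^ 2 * l ≤ S.μ * S.B ^ 2 * l ^ 2 := by gcongr
    have e3 : S.B * a + δ ≤ 3 * D := by
      have : S.B * (S.μ * (l * S.B)) = S.μ * S.B ^ 2 * l := by ring
      linarith
    have := mul_le_mul_of_nonneg_left e3 (show (0 : ℝ) ≤ N by linarith)
    linarith
  have h3 : 3 * (N * D) ≤ √T * (S.τ / (4 * K)) := by
    calc 3 * (N * D) = 12 * N * D * K / S.τ * (S.τ / (4 * K)) := by field_simp; norm_num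
      _ ≤ _ := by gcongr
  have h4 : √T * (N * S.B * a + N * δ) ≤ T * (S.τ / (4 * K)) := by
    calc √T * (N * S.B * a + N * δ) ≤ √T * (√T * (S.τ / (4 * K))) := by
          gcongr; exact h2.trans h3
      _ = T * (S.τ / (4 * K)) := by rw [← mul_assoc, Real.mul_self_sqrt hT0.le]
  have h5 : a ^ 2 / (2 * S.μ) ≤ S.μ * l ^ 2 * S.B ^ 2 / 2 := by
    calc a ^ 2 / (2 * S.μ) ≤ (S.μ * (l * S.B)) ^ 2 / (2 * S.μ) := by gcongr
      _ = _ := by field_simp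
  have h6 : S.τ * (S.μ * l ^ 2 * S.B ^ 2) ≤ D ^ 2 := by
    have e1 : 0 ≤ S.μ * l ^ 2 * S.B ^ 2 := by positivity
    have e2 : (S.τ / 2 + S.μ * l ^ 2 * S.B ^ 2 / 2) ^ 2 ≤ D ^ 2 := by gcongr
    nlinarith [sq_nonneg (S.τ / 2 - S.μ * l ^ 2 * S.B ^ 2 / 2)]
  have h7 : S.μ * l ^ 2 * S.B ^ 2 ≤ T * (S.τ / (4 * K)) := by
    have e0 : S.μ * l ^ 2 * S.B ^ 2 ≤ D ^ 2 / S.τ := by rw [le_div_iff₀ hτ]; linarith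
    have e1 : 1 * (D ^ 2 / S.τ) ≤ (36 * (N : ℝ) ^ 2 * K) * (D ^ 2 / S.τ) := by
      gcongr
      nlinarith [mul_le_mul hN hN zero_le_one (by linarith)]
    have e2 : (36 * (N : ℝ) ^ 2 * K) * (D ^ 2 / S.τ) =
        144 * (N : ℝ) ^ 2 * D ^ 2 * K ^ 2 / S.τ ^ 2 * (S.τ / (4 * K)) := by
      field_simp; norm_num
    have e3 : 144 * (N : ℝ) ^ 2 * D ^ 2 * K ^ 2 / S.τ ^ 2 * (S.τ / (4 * K)) ≤
        T * (S.τ / (4 * K)) := by gcongr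
    linarith
  have h8 : T * (S.τ / (2 * K)) = T * (S.τ / (4 * K)) + T * (S.τ / (4 * K)) := by
    field_simp; ring
  have h9 : 0 ≤ S.μ * l ^ 2 * S.B ^ 2 := by positivity
  linarith

theorem sum_stepTerm_le {A : ℕ → Bool → ℕ → Finset (Fin N)} {k : ℕ} {b : Bool}
    (hA : ∀ t, (A k b t).card = S.J) (w : E d) (lam : ℝ) :
    ∑ t ∈ Finset.range (S.T k b), (S.stepTerm (S.level b) w lam (S.iter A k b w lam t) (A k b t) +
        S.proxTerm (S.level b) w (S.iter A k b w lam t).1) ≤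
      √(S.T k b) * (N * S.B * ‖S.proxF (S.level b) w - w‖ +
        N * Metric.infDist lam (S.LambdaStar (S.level b) w)) +
      ‖S.proxF (S.level b) w - w‖ ^ 2 / (2 * S.μ) := by
  have hN : (0 : ℝ) < N := by exact_mod_cast R.N_pos
  obtain ⟨_, h2⟩ := lamProj_spec (S := S) (R.level_le b) w lam
  have h := sgdIter_regret (s := S.s) (J := S.J) (l := S.level b) (A := A k b) (w := w)
    (u := S.proxF (S.level b) w) (lam := lam) (lam' := S.lamProj (S.level b) w lam)
    (C := N * S.B) (M := N) (T := S.T k b) (η := S.η k b w) (θ := S.θ k b w lam) R.μ_pos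
    (mul_pos hN R.B_pos) hN
    (fun t v x => norm_gradV_le R.one_le_J R.B_pos.le R.norm_grad_le (hA t) v x)
    (fun t v x => abs_gradLam_le R.one_le_J (R.level_le b) (hA t) v x) (R.T_pos k b) rfl
    (by rw [← h2]; rfl)
  rw [h2]
  refine le_of_eq_of_le (Finset.sum_congr rfl fun t _ => ?_) h
  unfold stepTerm proxTerm iter
  ring

/-- The linearization loses `ρ/2`, quadratic growth of the proximal objective returns `τ/2`, and the
extra squared distance in `proxTerm` adds `1/(2μ)`. In total `τ/2 + 1/(2μ) - ρ/2 = τ`. -/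
theorem le_average_stepTerm {l : ℕ} (hl : l ≤ N) (w : E d) (lam : ℝ) (z : E d × ℝ) :
    S.gap l z + S.τ * ‖z.1 - S.proxF l w‖ ^ 2 ≤
      ((N.choose S.J : ℕ) : ℝ)⁻¹ *
        ∑ a ∈ Finset.powersetCard S.J (Finset.univ : Finset (Fin N)), S.stepTerm l w lam z a +
      S.proxTerm l w z.1 := by
  have hc : (0 : ℝ) < (N.choose S.J : ℕ) := by exact_mod_cast Nat.choose_pos R.J_le
  have h1 : ((N.choose S.J : ℕ) : ℝ)⁻¹ *
      ∑ a ∈ Finset.powersetCard S.J (Finset.univ : Finset (Fin N)), S.stepTerm l w lam z a =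
      l * (z.2 - S.lamProj l w lam) +
        ∑ j, linTerm S.s (S.proxF l w) (S.lamProj l w lam) z.1 z.2 j := by
    rw [← average_powersetCard R.one_le_J R.J_le]
    unfold stepTerm
    simp only [inner_gradV_add_gradLam]
    rw [Finset.sum_add_distrib, Finset.sum_const, Finset.card_powersetCard, Finset.card_univ,
      Fintype.card_fin, nsmul_eq_mul, mul_add, inv_mul_cancel_left₀ hc.ne']
  have h2 := hinge_linearization (l := l) R.diff R.smooth R.L_nonneg (S.proxF l w) z.1 z.2
    (S.lamProj l w lam)
  have h3 := (lamProj_spec (S := S) hl w lam).1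
  rw [LambdaStar_eq hl] at h3
  rw [hinge_eq_topSum hl h3, norm_sub_rev] at h2
  have h4 := prox_growth R.μ_pos (R.abs_f_sub_le hl) (R.weaklyConvex_f hl) w z.1
  rw [h1]
  unfold gap proxTerm τ
  change S.g l z.1 z.2 - S.f l (S.proxF l w) - S.ρ / 2 * ‖z.1 - S.proxF l w‖ ^ 2 ≤ _ at h2
  change S.f l (S.proxF l w) + ‖S.proxF l w - w‖ ^ 2 / (2 * S.μ) +
    (1 / S.μ - S.ρ) / 2 * ‖z.1 - S.proxF l w‖ ^ 2 ≤ _ at h4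
  rw [norm_sub_rev (S.proxF l w) z.1]
  have h5 : ‖z.1 - S.proxF l w‖ ^ 2 / (2 * S.μ) = 1 / S.μ / 2 * ‖z.1 - S.proxF l w‖ ^ 2 := by
    field_simp
  rw [h5, ← one_div]
  linarith

theorem norm_innerRun_fst_sub_sq_le (A : ℕ → Bool → ℕ → Finset (Fin N)) (k : ℕ) (b : Bool)
    (w u : E d) (lam : ℝ) :
    ‖(S.innerRun A k b w lam).1 - u‖ ^ 2 ≤ (S.T k b : ℝ)⁻¹ *
      ∑ t ∈ Finset.range (S.T k b), ‖(S.iter A k b w lam t).1 - u‖ ^ 2 := by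
  have hT : (0 : ℝ) < S.T k b := by exact_mod_cast R.T_pos k b
  have h1 : (S.innerRun A k b w lam).1 - u = (S.T k b : ℝ)⁻¹ •
      ∑ t ∈ Finset.range (S.T k b), ((S.iter A k b w lam t).1 - u) := by
    rw [Finset.sum_sub_distrib, Finset.sum_const, Finset.card_range, smul_sub,
      ← Nat.cast_smul_eq_nsmul ℝ, inv_smul_smul₀ hT.ne']
    unfold innerRun sgd iter
    rw [Prod.smul_fst, Prod.fst_sum]
  have h2 : ‖∑ t ∈ Finset.range (S.T k b), ((S.iter A k b w lam t).1 - u)‖ ^ 2 ≤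
      S.T k b * ∑ t ∈ Finset.range (S.T k b), ‖(S.iter A k b w lam t).1 - u‖ ^ 2 := by
    have h3 := norm_sum_le (Finset.range (S.T k b)) fun t => (S.iter A k b w lam t).1 - u
    have h4 := sq_sum_le_card_mul_sum_sq (s := Finset.range (S.T k b))
      (f := fun t => ‖(S.iter A k b w lam t).1 - u‖)
    rw [Finset.card_range] at h4
    exact (pow_le_pow_left₀ (norm_nonneg _) h3 2).trans h4
  rw [h1, norm_smul, mul_pow, Real.norm_of_nonneg (by positivity)]
  calc (S.T k b : ℝ)⁻¹ ^ 2 * _ ≤ (S.T k b : ℝ)⁻¹ ^ 2 *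
        (S.T k b * ∑ t ∈ Finset.range (S.T k b), ‖(S.iter A k b w lam t).1 - u‖ ^ 2) := by gcongr
    _ = _ := by field_simp

theorem infDist_innerRun_snd_le (A : ℕ → Bool → ℕ → Finset (Fin N)) (k : ℕ) (b : Bool)
    (w : E d) (lam : ℝ) :
    Metric.infDist (S.innerRun A k b w lam).2 (S.LambdaStar (S.level b) w) ≤ (S.T k b : ℝ)⁻¹ *
      ∑ t ∈ Finset.range (S.T k b), (S.gap (S.level b) (S.iter A k b w lam t) +
        S.B * ‖(S.iter A k b w lam t).1 - S.proxF (S.level b) w‖) := by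
  choose x hx hle using fun t => R.exists_mem_LambdaStar (R.level_le b) w (S.iter A k b w lam t)
  have hmem : (S.T k b : ℝ)⁻¹ * ∑ t ∈ Finset.range (S.T k b), x t ∈
      S.LambdaStar (S.level b) w := by
    rw [LambdaStar_eq (R.level_le b)] at hx ⊢
    exact average_mem_thresholds (R.T_pos k b) hx
  refine (Metric.infDist_le_dist_of_mem hmem).trans ?_
  have h1 : (S.innerRun A k b w lam).2 =
      (S.T k b : ℝ)⁻¹ * ∑ t ∈ Finset.range (S.T k b), (S.iter A k b w lam t).2 := by
    unfold innerRun sgd iter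
    rw [Prod.smul_snd, Prod.snd_sum, smul_eq_mul]
  rw [Real.dist_eq, h1, ← mul_sub, ← Finset.sum_sub_distrib, abs_mul,
    abs_of_nonneg (inv_nonneg.2 (Nat.cast_nonneg _))]
  gcongr
  exact (Finset.abs_sum_le_sum_abs _ _).trans (Finset.sum_le_sum fun t _ => hle t)

end Regular

end Setup

end SoRR

namespace SoRR

/-! ### Random variables that depend on finitely many samples -/

section Probability

variable {Ω : Type*} [MeasurableSpace Ω] {P : Measure Ω} [IsProbabilityMeasure P]

section Uniform

variable {G : Type*} [MeasurableSpace G] [MeasurableSingletonClass G] {s : Finset G} {Y : Ω → G}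

omit [IsProbabilityMeasure P] in
theorem ae_mem_of_map_eq_uniformOn (hY : Measurable Y) (hlaw : P.map Y = uniformOn (s : Set G)) :
    ∀ᵐ ω ∂P, Y ω ∈ s := by
  have h : P.map Y (s : Set G)ᶜ = 0 := by
    rw [hlaw, uniformOn_eq_zero_iff s.finite_toSet, Set.inter_compl_self]
  rw [Measure.map_apply hY s.measurableSet.compl] at h
  exact measure_eq_zero_iff_ae_notMem.1 h |>.mono fun ω hω => by simpa using hω

omit [IsProbabilityMeasure P] in
theorem measureReal_preimage_of_uniformOn (hY : Measurable Y)
    (hlaw : P.map Y = uniformOn (s : Set G)) {a : G} (ha : a ∈ s) :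
    P.real (Y ⁻¹' {a}) = (s.card : ℝ)⁻¹ := by
  classical
  rw [measureReal_def, ← Measure.map_apply hY (measurableSet_singleton a), hlaw,
    ← Finset.coe_singleton, uniformOn_apply_finset, Finset.inter_singleton_of_mem ha]
  simp

theorem integral_comp_uniform (hY : Measurable Y) (hlaw : P.map Y = uniformOn (s : Set G))
    {Ψ : Ω → G → ℝ} (hint : ∀ a ∈ s, Integrable (fun ω => Ψ ω a) P)
    (hind : ∀ a ∈ s, IndepFun (fun ω => Ψ ω a) Y P) :
    Integrable (fun ω => Ψ ω (Y ω)) P ∧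
      ∫ ω, Ψ ω (Y ω) ∂P = (s.card : ℝ)⁻¹ * ∑ a ∈ s, ∫ ω, Ψ ω a ∂P := by
  classical
  have hae : (fun ω => Ψ ω (Y ω)) =ᵐ[P]
      fun ω => ∑ a ∈ s, ((fun ω => Ψ ω a) * (Y ⁻¹' {a}).indicator (1 : Ω → ℝ)) ω := by
    filter_upwards [ae_mem_of_map_eq_uniformOn hY hlaw] with ω hω
    rw [Finset.sum_eq_single (Y ω)]
    · simp
    · intro a _ hne
      simp [Set.indicator, hne.symm]
    · exact fun h => absurd hω h
  have hmeas : ∀ a, MeasurableSet (Y ⁻¹' {a}) := fun a => hY (measurableSet_singleton a)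
  have hI : ∀ a, Integrable ((Y ⁻¹' {a}).indicator (1 : Ω → ℝ)) P := fun a =>
    (integrable_const 1).indicator (hmeas a)
  have hind' : ∀ a ∈ s, IndepFun (fun ω => Ψ ω a) ((Y ⁻¹' {a}).indicator (1 : Ω → ℝ)) P := by
    intro a ha
    have h : Measurable (({a} : Set G).indicator (1 : G → ℝ)) :=
      measurable_one.indicator (measurableSet_singleton a)
    exact (hind a ha).comp measurable_id h
  have hprod : ∀ a ∈ s, Integrable ((fun ω => Ψ ω a) * (Y ⁻¹' {a}).indicator (1 : Ω → ℝ)) P :=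
    fun a ha => (hind' a ha).integrable_mul (hint a ha) (hI a)
  refine ⟨(integrable_finsetSum _ hprod).congr hae.symm, ?_⟩
  rw [integral_congr_ae hae, integral_finsetSum _ hprod, Finset.mul_sum]
  refine Finset.sum_congr rfl fun a ha => ?_
  rw [(hind' a ha).integral_mul_eq_mul_integral (hint a ha).aestronglyMeasurable
    (hI a).aestronglyMeasurable, integral_indicator_one (hmeas a),
    measureReal_preimage_of_uniformOn hY hlaw ha, mul_comm]

end Uniform

section DependsOn

variable {ι F : Type*} [Finite F] [MeasurableSpace F] [MeasurableSingletonClass F]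
  {A : ι → Ω → F} {β : Type*} {Φ : (ι → F) → β} {I : Finset ι}

omit [MeasurableSpace Ω] [Finite F] [MeasurableSpace F] [MeasurableSingletonClass F] in
theorem exists_eq_comp_of_dependsOn [Nonempty Ω] (A : ι → Ω → F) (hΦ : DependsOn Φ I) :
    ∃ g : (I → F) → β, ∀ ω, Φ (fun i => A i ω) = g fun i => A i ω := by
  have : Nonempty β := ⟨Φ fun i => A i (Classical.arbitrary Ω)⟩
  obtain ⟨g, hg⟩ := dependsOn_iff_exists_comp.1 hΦ
  exact ⟨g, fun ω => by rw [hg]; rfl⟩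

omit [IsProbabilityMeasure P] in
theorem measurable_of_dependsOn [MeasurableSpace β] (hA : ∀ i, Measurable (A i))
    (hΦ : DependsOn Φ I) : Measurable fun ω => Φ fun i => A i ω := by
  cases isEmpty_or_nonempty Ω
  · exact measurable_of_empty _
  obtain ⟨g, hg⟩ := exists_eq_comp_of_dependsOn A hΦ
  simp only [hg]
  exact (measurable_of_finite g).comp (measurable_pi_lambda _ fun i => hA i)

theorem integrable_of_dependsOn [NormedAddCommGroup β] (hA : ∀ i, Measurable (A i))
    (hΦ : DependsOn Φ I) : Integrable (fun ω => Φ fun i => A i ω) P := by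
  have : Nonempty Ω := nonempty_of_isProbabilityMeasure P
  obtain ⟨g, hg⟩ := exists_eq_comp_of_dependsOn A hΦ
  simp only [hg]
  have hm : Measurable fun ω (i : I) => A i ω := measurable_pi_lambda _ fun i => hA i
  have := Measure.isProbabilityMeasure_map (μ := P) hm.aemeasurable
  exact (Integrable.of_finite (f := g)).comp_measurable hm

theorem indepFun_of_dependsOn [MeasurableSpace β] (hA : ∀ i, Measurable (A i))
    (hind : iIndepFun A P) (hΦ : DependsOn Φ I) {i : ι} (hi : i ∉ I) :
    IndepFun (fun ω => Φ fun i => A i ω) (A i) P := by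
  have : Nonempty Ω := nonempty_of_isProbabilityMeasure P
  obtain ⟨g, hg⟩ := exists_eq_comp_of_dependsOn A hΦ
  simp only [hg]
  exact (hind.indepFun_finset I {i} (Finset.disjoint_singleton_right.2 hi) hA).comp
    (measurable_of_finite g) (measurable_pi_apply (⟨i, Finset.mem_singleton_self i⟩ : ({i} : Finset ι)))

omit [Finite F] [MeasurableSpace F] [MeasurableSingletonClass F] in
theorem dependsOn_comp (hΦ : DependsOn Φ I) {δ : Type*} (h : β → δ) :
    DependsOn (fun x => h (Φ x)) I := fun _ _ hxy => congrArg h (hΦ hxy)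

/-- Averaging over one uniform sample that is independent of the past. -/
theorem integral_sample_eq {s : Finset F} (hA : ∀ i, Measurable (A i)) (hind : iIndepFun A P)
    {i : ι} (hlaw : P.map (A i) = uniformOn (s : Set F)) (hi : i ∉ I) (hΦ : DependsOn Φ I)
    (h : β → F → ℝ) :
    Integrable (fun ω => h (Φ fun i => A i ω) (A i ω)) P ∧
      ∫ ω, h (Φ fun i => A i ω) (A i ω) ∂P =
        ∫ ω, (s.card : ℝ)⁻¹ * ∑ a ∈ s, h (Φ fun i => A i ω) a ∂P := by
  have hint : ∀ a, Integrable (fun ω => h (Φ fun i => A i ω) a) P := fun a =>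
    integrable_of_dependsOn hA (dependsOn_comp hΦ fun x => h x a)
  obtain ⟨h1, h2⟩ := integral_comp_uniform (hA i) hlaw (Ψ := fun ω a => h (Φ fun i => A i ω) a)
    (fun a _ => hint a)
    (fun a _ => indepFun_of_dependsOn hA hind (dependsOn_comp hΦ fun x => h x a) hi)
  refine ⟨h1, h2.trans ?_⟩
  rw [integral_const_mul, integral_finsetSum _ fun a _ => hint a]

end DependsOn

end Probability

end SoRR

/-! ### One outer iteration along a fixed sample path -/

namespace SoRR

variable {d N : ℕ}

namespace Setup

/-- The outer iterate `w^(k)` along the sample path `A`. -/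
noncomputable def w (S : Setup d N) (A : ℕ → Bool → ℕ → Finset (Fin N)) (k : ℕ) : E d :=
  (S.agd A k).1

/-- The threshold from which the inner run `b` of iteration `k` starts. -/
noncomputable def lam (S : Setup d N) (A : ℕ → Bool → ℕ → Finset (Fin N)) (k : ℕ) (b : Bool) :
    ℝ := (S.agd A k).2 b

/-- The inner iterates along the sample path `A`. -/
noncomputable def z (S : Setup d N) (A : ℕ → Bool → ℕ → Finset (Fin N)) (k : ℕ) (b : Bool)
    (t : ℕ) : E d × ℝ := S.iter A k b (S.w A k) (S.lam A k b) t

/-- The averaged inner iterate. -/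
noncomputable def out (S : Setup d N) (A : ℕ → Bool → ℕ → Finset (Fin N)) (k : ℕ) (b : Bool) :
    E d := (S.innerRun A k b (S.w A k) (S.lam A k b)).1

/-- The exact proximal point of `w^(k)`. -/
noncomputable def u (S : Setup d N) (A : ℕ → Bool → ℕ → Finset (Fin N)) (k : ℕ) (b : Bool) :
    E d := S.proxF (S.level b) (S.w A k)

/-- The distance of the initial threshold to the optimal thresholds. -/
noncomputable def δ (S : Setup d N) (A : ℕ → Bool → ℕ → Finset (Fin N)) (k : ℕ) (b : Bool) : ℝ :=
  Metric.infDist (S.lam A k b) (S.LambdaStar (S.level b) (S.w A k))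

/-- The average suboptimality of the thresholds in an inner run. -/
noncomputable def avgGap (S : Setup d N) (A : ℕ → Bool → ℕ → Finset (Fin N)) (k : ℕ)
    (b : Bool) : ℝ :=
  (S.T k b : ℝ)⁻¹ * ∑ t ∈ Finset.range (S.T k b), S.gap (S.level b) (S.z A k b t)

/-- The average squared distance of the inner iterates to the proximal point. -/
noncomputable def avgSq (S : Setup d N) (A : ℕ → Bool → ℕ → Finset (Fin N)) (k : ℕ)
    (b : Bool) : ℝ :=
  (S.T k b : ℝ)⁻¹ * ∑ t ∈ Finset.range (S.T k b), ‖(S.z A k b t).1 - S.u A k b‖ ^ 2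

/-- The smoothed objective. -/
noncomputable def smoothed (S : Setup d N) (w : E d) : ℝ :=
  envelope S.μ (S.f S.n) w - envelope S.μ (S.f S.m) w

theorem w_succ (S : Setup d N) (A : ℕ → Bool → ℕ → Finset (Fin N)) (k : ℕ) :
    S.w A (k + 1) = S.w A k - (S.γ * S.μ⁻¹) • (S.out A k false - S.out A k true) := rfl

namespace Regular

variable {S : Setup d N} (R : S.Regular) (A : ℕ → Bool → ℕ → Finset (Fin N)) (k : ℕ)
include R

theorem m_le : S.m ≤ N := R.m_lt_n.le.trans R.n_le

theorem norm_out_sub_sq_le (b : Bool) : ‖S.out A k b - S.u A k b‖ ^ 2 ≤ S.avgSq A k b :=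
  R.norm_innerRun_fst_sub_sq_le A k b _ _ _

/-- Trades the norm for its square, so that later expectations involve only `avgSq`, linearly. -/
theorem norm_out_sub_le (b : Bool) : ‖S.out A k b - S.u A k b‖ ≤ (1 + S.avgSq A k b) / 2 := by
  have h := R.norm_out_sub_sq_le A k b
  nlinarith [sq_nonneg (‖S.out A k b - S.u A k b‖ - 1)]

omit R in
theorem avgSq_nonneg (b : Bool) : 0 ≤ S.avgSq A k b := by
  unfold avgSq; positivity

theorem avgGap_nonneg (b : Bool) : 0 ≤ S.avgGap A k b :=
  mul_nonneg (by positivity) (Finset.sum_nonneg fun _ _ => gap_nonneg (R.level_le b) _)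

theorem norm_u_sub_w_le (b : Bool) : ‖S.u A k b - S.w A k‖ ≤ S.μ * (S.level b * S.B) :=
  R.norm_proxF_sub_le (R.level_le b) _

theorem norm_w_succ_sub_le : ‖S.w A (k + 1) - S.w A k‖ ≤
    S.γ / S.μ * ((1 + S.avgSq A k false) / 2 + (1 + S.avgSq A k true) / 2) +
      (S.γ * S.n * S.B + S.γ * S.m * S.B) := by
  have hμ := R.μ_pos
  have hγ := R.γ_pos
  have h1 : S.w A (k + 1) - S.w A k =
      -((S.γ * S.μ⁻¹) • ((S.out A k false - S.u A k false) - (S.out A k true - S.u A k true) +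
        ((S.u A k false - S.w A k) - (S.u A k true - S.w A k)))) := by
    rw [w_succ]; module
  have h2 := R.norm_out_sub_le A k false
  have h3 := R.norm_out_sub_le A k true
  have h4 := R.norm_u_sub_w_le A k false
  have h5 := R.norm_u_sub_w_le A k true
  change _ ≤ S.μ * (S.m * S.B) at h4
  change _ ≤ S.μ * (S.n * S.B) at h5
  have h6 := norm_add_le ((S.out A k false - S.u A k false) - (S.out A k true - S.u A k true))
    ((S.u A k false - S.w A k) - (S.u A k true - S.w A k))
  have h7 := norm_sub_le (S.out A k false - S.u A k false) (S.out A k true - S.u A k true)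
  have h8 := norm_sub_le (S.u A k false - S.w A k) (S.u A k true - S.w A k)
  rw [h1, norm_neg, norm_smul, Real.norm_of_nonneg (by positivity)]
  calc S.γ * S.μ⁻¹ * _ ≤ S.γ * S.μ⁻¹ * ((1 + S.avgSq A k false) / 2 + (1 + S.avgSq A k true) / 2 +
        (S.μ * (S.m * S.B) + S.μ * (S.n * S.B))) := by
        gcongr
        linarith
    _ = _ := by field_simp; ring

/-- The returned threshold is near the optimal set at the old `w`, and that set moves by at most a
multiple of the outer step. The bound is linear in `avgGap` and `avgSq`, so it survives taking
expectations. -/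
theorem δ_succ_le (b : Bool) : S.δ A (k + 1) b ≤
    S.avgGap A k b + S.B / 2 * (1 + S.avgSq A k b) + S.B / (1 - S.μ * S.ρ) *
      (S.γ / S.μ * ((1 + S.avgSq A k false) / 2 + (1 + S.avgSq A k true) / 2) +
        (S.γ * S.n * S.B + S.γ * S.m * S.B)) := by
  have h1 := R.infDist_LambdaStar_le (R.level_le b) (S.w A k) (S.w A (k + 1)) (S.lam A (k + 1) b)
  have h2 := R.infDist_innerRun_snd_le A k b (S.w A k) (S.lam A k b)
  have h3 := mul_le_mul_of_nonneg_left (R.norm_w_succ_sub_le A k)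
    (div_pos R.B_pos R.one_sub_pos).le
  have hB := R.B_pos
  have hT : (0 : ℝ) < S.T k b := by exact_mod_cast R.T_pos k b
  have h4 : (S.T k b : ℝ)⁻¹ * ∑ t ∈ Finset.range (S.T k b), (S.gap (S.level b) (S.z A k b t) +
      S.B * ‖(S.z A k b t).1 - S.u A k b‖) ≤ S.avgGap A k b + S.B / 2 * (1 + S.avgSq A k b) := by
    have h5 : S.avgGap A k b + S.B / 2 * (1 + S.avgSq A k b) = (S.T k b : ℝ)⁻¹ *
        ∑ t ∈ Finset.range (S.T k b), (S.gap (S.level b) (S.z A k b t) +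
          S.B / 2 * (1 + ‖(S.z A k b t).1 - S.u A k b‖ ^ 2)) := by
      unfold avgGap avgSq
      rw [Finset.sum_add_distrib, ← Finset.mul_sum, Finset.sum_add_distrib, Finset.sum_const,
        Finset.card_range, nsmul_eq_mul]
      field_simp
    rw [h5]
    refine mul_le_mul_of_nonneg_left (Finset.sum_le_sum fun t _ => ?_) (by positivity)
    nlinarith [sq_nonneg (‖(S.z A k b t).1 - S.u A k b‖ - 1)]
  exact (h1.trans (add_le_add_left (h2.trans h4) _)).trans (by linarith)

/-- Upper curvature `1/μ` of the first envelope and lower curvature `1/(μ(1-μρ)) - 1/μ` of the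
second add up to `Lμ / 2`. -/
theorem smoothed_le (w w' : E d) : S.smoothed w' ≤ S.smoothed w +
    S.μ⁻¹ * ⟪S.proxF S.m w - S.proxF S.n w, w' - w⟫ + S.Lμ / 4 * ‖w' - w‖ ^ 2 := by
  have h1 := envelope_le R.μ_pos (R.abs_f_sub_le R.n_le) w w'
  have h2 := le_envelope R.μ_pos (R.abs_f_sub_le R.m_le) (R.weaklyConvex_f R.m_le) R.ρ_lt w w'
  have h3 : ⟪S.proxF S.m w - S.proxF S.n w, w' - w⟫ =
      ⟪w - S.proxF S.n w, w' - w⟫ - ⟪w - S.proxF S.m w, w' - w⟫ := by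
    rw [← inner_sub_left]; congr 1; abel
  have hμ := R.μ_pos
  have h4 : S.Lμ / 4 * ‖w' - w‖ ^ 2 =
      (1 / (S.μ * (1 - S.μ * S.ρ)) - 1 / S.μ) * ‖w' - w‖ ^ 2 / 2 +
        ‖w' - w‖ ^ 2 / (2 * S.μ) := by
    have h5 : S.Lμ = 2 * (1 / (S.μ * (1 - S.μ * S.ρ))) := by
      rw [Lμ, show S.μ - S.μ ^ 2 * S.ρ = S.μ * (1 - S.μ * S.ρ) by ring]; ring
    rw [h5]
    ring
  unfold smoothed
  rw [h3, h4]
  change _ ≤ _ + S.μ⁻¹ * ⟪w - S.proxF S.n w, w' - w⟫ + _ at h1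
  change _ + S.μ⁻¹ * ⟪w - S.proxF S.m w, w' - w⟫ - _ ≤ _ at h2
  linarith

theorem norm_u_sub_u_sq_le : ‖S.u A k false - S.u A k true‖ ^ 2 ≤
    2 * S.μ ^ 2 / S.γ * (S.smoothed (S.w A k) - S.smoothed (S.w A (k + 1))) +
      2 * (S.avgSq A k false + S.avgSq A k true) := by
  have hμ := R.μ_pos
  have hγ := R.γ_pos
  have h1 := R.smoothed_le (S.w A k) (S.w A (k + 1))
  have h2 : S.w A (k + 1) - S.w A k =
      -((S.γ * S.μ⁻¹) • (S.out A k false - S.out A k true)) := by rw [w_succ]; abel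
  change _ ≤ _ + S.μ⁻¹ * ⟪S.u A k false - S.u A k true, _⟫ + _ at h1
  have h3 := R.norm_out_sub_sq_le A k false
  have h4 := R.norm_out_sub_sq_le A k true
  have h5 : ‖(S.out A k false - S.out A k true) - (S.u A k false - S.u A k true)‖ ^ 2 ≤
      2 * (S.avgSq A k false + S.avgSq A k true) := by
    rw [show (S.out A k false - S.out A k true) - (S.u A k false - S.u A k true) =
      (S.out A k false - S.u A k false) - (S.out A k true - S.u A k true) by abel]
    have h6 := norm_sub_le (S.out A k false - S.u A k false) (S.out A k true - S.u A k true)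
    have h7 := pow_le_pow_left₀ (norm_nonneg _) h6 2
    nlinarith [sq_nonneg (‖S.out A k false - S.u A k false‖ - ‖S.out A k true - S.u A k true‖)]
  rw [h2, inner_neg_right, inner_smul_right, norm_neg, norm_smul,
    Real.norm_of_nonneg (by positivity)] at h1
  rw [norm_sub_sq_real, real_inner_comm] at h5
  generalize S.out A k false - S.out A k true = p at *
  generalize S.u A k false - S.u A k true = q at *
  have h6 : S.Lμ / 4 * (S.γ * S.μ⁻¹ * ‖p‖) ^ 2 ≤ S.γ * (S.μ⁻¹) ^ 2 * ‖p‖ ^ 2 / 2 := by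
    have h7 : 0 < S.Lμ := by
      unfold Lμ
      rw [show S.μ - S.μ ^ 2 * S.ρ = S.μ * (1 - S.μ * S.ρ) by ring]
      have := R.one_sub_pos
      positivity
    have h8 : S.γ * S.Lμ ≤ 1 := (le_div_iff₀ h7).1 R.γ_le
    have h9 : 0 ≤ S.γ * (S.μ⁻¹) ^ 2 * ‖p‖ ^ 2 := by positivity
    have h10 := mul_le_mul_of_nonneg_right h8 h9
    have h11 : S.Lμ / 4 * (S.γ * S.μ⁻¹ * ‖p‖) ^ 2 =
        S.γ * S.Lμ * (S.γ * (S.μ⁻¹) ^ 2 * ‖p‖ ^ 2) / 4 := by ring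
    linarith
  -- Inexact descent: `2⟪q, p⟫ - ‖p‖² = ‖q‖² - ‖p - q‖²`, where `q` is the exact direction and `p`
  -- the computed one, so the inner errors enter only through `‖p - q‖²`.
  have h7 : S.γ * (S.μ⁻¹) ^ 2 / 2 * (2 * ⟪q, p⟫ - ‖p‖ ^ 2) ≤
      S.smoothed (S.w A k) - S.smoothed (S.w A (k + 1)) := by
    have e : S.μ⁻¹ * (S.γ * S.μ⁻¹ * ⟪q, p⟫) = S.γ * (S.μ⁻¹) ^ 2 / 2 * (2 * ⟪q, p⟫) := by ring
    linarith
  have h8 : 2 * ⟪q, p⟫ - ‖p‖ ^ 2 ≤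
      2 * S.μ ^ 2 / S.γ * (S.smoothed (S.w A k) - S.smoothed (S.w A (k + 1))) := by
    have h9 := mul_le_mul_of_nonneg_left h7 (show 0 ≤ 2 * S.μ ^ 2 / S.γ by positivity)
    refine le_of_eq_of_le ?_ h9
    field_simp
  linarith

theorem smoothed_le_F (w : E d) : S.smoothed w ≤ S.F (S.proxF S.m w) := by
  have h := prox_le R.μ_pos (R.abs_f_sub_le R.n_le) w (S.proxF S.m w)
  unfold smoothed envelope F
  unfold proxF at h ⊢
  linarith

theorem Fstar_le_smoothed (w : E d) : S.Fstar ≤ S.smoothed w := by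
  have h := prox_le R.μ_pos (R.abs_f_sub_le R.m_le) w (S.proxF S.n w)
  refine (ciInf_le R.bddBelow (S.proxF S.n w)).trans ?_
  unfold smoothed envelope F
  unfold proxF at h ⊢
  linarith

theorem sum_norm_u_sub_u_sq_le (K : ℕ) :
    ∑ k ∈ Finset.range K, ‖S.u A k false - S.u A k true‖ ^ 2 ≤
      2 * S.μ ^ 2 / S.γ * (S.F (S.proxF S.m S.w₀) - S.Fstar) +
        ∑ k ∈ Finset.range K, 2 * (S.avgSq A k false + S.avgSq A k true) := by
  have h1 := Finset.sum_le_sum fun k (_ : k ∈ Finset.range K) => R.norm_u_sub_u_sq_le A k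
  rw [Finset.sum_add_distrib, ← Finset.mul_sum, Finset.sum_range_sub'] at h1
  refine h1.trans (add_le_add_left ?_ _)
  have hγ := R.γ_pos
  have h2 := R.smoothed_le_F S.w₀
  have h3 := R.Fstar_le_smoothed (S.w A K)
  have h4 : S.w A 0 = S.w₀ := rfl
  rw [h4]
  gcongr

theorem norm_smul_sub_mem_subdiff :
    S.μ⁻¹ • (S.w A k - S.u A k true) ∈ subdiff (S.f S.n) (S.u A k true) ∧
      S.μ⁻¹ • (S.w A k - S.u A k false) ∈ subdiff (S.f S.m) (S.u A k false) :=
  ⟨smul_sub_prox_mem_subdiff R.μ_pos (R.abs_f_sub_le R.n_le) _,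
    smul_sub_prox_mem_subdiff R.μ_pos (R.abs_f_sub_le R.m_le) _⟩

end Regular

end Setup

end SoRR

/-! ### Which samples each quantity depends on -/

namespace SoRR

variable {d N : ℕ}

theorem sgdIter_congr {s : Fin N → E d → ℝ} {J l : ℕ} {μ : ℝ} {η θ : ℕ → ℝ}
    {A A' : ℕ → Finset (Fin N)} {w : E d} {lam : ℝ} {t : ℕ} (h : ∀ r < t, A r = A' r) :
    sgdIter s J l μ η θ A w lam t = sgdIter s J l μ η θ A' w lam t := by
  induction t with
  | zero => rfl
  | succ t ih =>
    rw [sgdIter, sgdIter, ih fun r hr => h r (Nat.lt_succ_of_lt hr), h t (Nat.lt_succ_self t)]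

namespace Setup

variable (S : Setup d N)

/-- The sample indices that are used before iteration `k`. -/
noncomputable def past (k : ℕ) : Finset (ℕ × Bool × ℕ) :=
  (Finset.range k).biUnion fun k' => Finset.univ.biUnion fun b =>
    (Finset.range (S.T k' b)).image fun t => (k', b, t)

/-- The sample indices that are used before step `t` of the inner run `b` of iteration `k`. -/
noncomputable def pastIter (k : ℕ) (b : Bool) (t : ℕ) : Finset (ℕ × Bool × ℕ) :=
  S.past k ∪ (Finset.range t).image fun r => (k, b, r)

variable {S}

theorem mem_past {k k' t : ℕ} {b : Bool} : (k', b, t) ∈ S.past k ↔ k' < k ∧ t < S.T k' b := by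
  simp only [past, Finset.mem_biUnion, Finset.mem_range, Finset.mem_univ, true_and,
    Finset.mem_image, Prod.mk.injEq]
  constructor
  · rintro ⟨_, h1, _, _, h2, rfl, rfl, rfl⟩
    exact ⟨h1, h2⟩
  · rintro ⟨h1, h2⟩
    exact ⟨k', h1, b, t, h2, rfl, rfl, rfl⟩

theorem notMem_pastIter (k : ℕ) (b : Bool) (t : ℕ) : (k, b, t) ∉ S.pastIter k b t := by
  simp [pastIter, mem_past]

theorem iter_congr {A A' : ℕ → Bool → ℕ → Finset (Fin N)} {k t : ℕ} {b : Bool} {w : E d}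
    {lam : ℝ} (h : ∀ r < t, A k b r = A' k b r) : S.iter A k b w lam t = S.iter A' k b w lam t :=
  sgdIter_congr h

theorem innerRun_congr {A A' : ℕ → Bool → ℕ → Finset (Fin N)} {k : ℕ} {b : Bool} {w : E d}
    {lam : ℝ} (h : ∀ t < S.T k b, A k b t = A' k b t) :
    S.innerRun A k b w lam = S.innerRun A' k b w lam := by
  unfold innerRun sgd
  congr 1
  exact Finset.sum_congr rfl fun t ht =>
    sgdIter_congr fun r hr => h r (hr.trans (Finset.mem_range.1 ht))

theorem agd_congr {A A' : ℕ → Bool → ℕ → Finset (Fin N)} {k : ℕ}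
    (h : ∀ k' < k, ∀ b, ∀ t < S.T k' b, A k' b t = A' k' b t) : S.agd A k = S.agd A' k := by
  induction k with
  | zero => rfl
  | succ k ih =>
    have h1 := ih fun k' hk' => h k' (Nat.lt_succ_of_lt hk')
    have h2 : ∀ b, S.innerRun A k b (S.agd A' k).1 ((S.agd A' k).2 b) =
        S.innerRun A' k b (S.agd A' k).1 ((S.agd A' k).2 b) :=
      fun b => innerRun_congr (h k (Nat.lt_succ_self k) b)
    simp only [agd, h1, h2]

/-- The sample path as a function of three arguments. -/
def path (x : ℕ × Bool × ℕ → Finset (Fin N)) : ℕ → Bool → ℕ → Finset (Fin N) :=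
  fun k b t => x (k, b, t)

theorem dependsOn_agd (k : ℕ) : DependsOn (fun x => S.agd (path x) k) (S.past k) :=
  fun _ _ h => agd_congr fun _ hk' _ _ ht => h _ (mem_past.2 ⟨hk', ht⟩)

theorem dependsOn_iter (k : ℕ) (b : Bool) (t : ℕ) :
    DependsOn (fun x => (S.agd (path x) k, S.z (path x) k b t)) (S.pastIter k b t) := by
  intro x y h
  have h1 : S.agd (path x) k = S.agd (path y) k :=
    dependsOn_agd k fun i hi => h i (Finset.mem_union_left _ hi)
  simp only [z, w, lam, h1]
  rw [iter_congr (A := path x) (A' := path y)]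
  intro r hr
  exact h _ (Finset.mem_union_right _ (Finset.mem_image_of_mem _ (Finset.mem_range.2 hr)))

/-- The quantities that describe iteration `k`. -/
theorem dependsOn_iteration (k : ℕ) :
    DependsOn (fun x => (S.w (path x) k, S.δ (path x) k, S.out (path x) k,
      S.u (path x) k, S.avgGap (path x) k, S.avgSq (path x) k)) (S.past (k + 1)) := by
  intro x y h
  have h1 : S.agd (path x) k = S.agd (path y) k :=
    dependsOn_agd k fun i hi => h i <| by
      obtain ⟨k', b, t⟩ := i
      rw [Finset.mem_coe, mem_past] at hi ⊢
      exact ⟨hi.1.trans (Nat.lt_succ_self k), hi.2⟩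
  have h2 : ∀ b, ∀ t < S.T k b, path x k b t = path y k b t := fun b t ht =>
    h _ (mem_past.2 ⟨Nat.lt_succ_self k, ht⟩)
  have h3 : ∀ b, ∀ t ∈ Finset.range (S.T k b), S.z (path x) k b t = S.z (path y) k b t := by
    intro b t ht
    simp only [z, w, lam, h1]
    exact iter_congr fun r hr => h2 b r (hr.trans (Finset.mem_range.1 ht))
  have hw : S.w (path x) k = S.w (path y) k := by simp only [w, h1]
  have hu : S.u (path x) k = S.u (path y) k := by funext b; simp only [u, hw]
  have hδ : S.δ (path x) k = S.δ (path y) k := by funext b; simp only [δ, w, lam, h1]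
  have ho : S.out (path x) k = S.out (path y) k := by
    funext b
    simp only [out, w, lam, h1]
    rw [innerRun_congr (h2 b)]
  have hg : S.avgGap (path x) k = S.avgGap (path y) k := by
    funext b
    unfold avgGap
    rw [Finset.sum_congr rfl fun t ht => by rw [h3 b t ht]]
  have hs : S.avgSq (path x) k = S.avgSq (path y) k := by
    funext b
    unfold avgSq
    rw [Finset.sum_congr rfl fun t ht => by rw [h3 b t ht, hu]]
  simp only [hw, hu, hδ, ho, hg, hs]

end Setup

/-! ### Expected error of the inner runs -/

section Expectation

variable {Ω : Type*} [MeasurableSpace Ω] {P : Measure Ω} [IsProbabilityMeasure P] {S : Setup d N}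
  {K : ℕ} {A : ℕ × Bool × ℕ → Ω → Finset (Fin N)} {kbar : Ω → ℕ}

theorem integral_add_add_add_const {f g h k : Ω → ℝ} (hf : Integrable f P) (hg : Integrable g P)
    (hh : Integrable h P) (hk : Integrable k P) (c : ℝ) :
    ∫ ω, (f ω + g ω + h ω + k ω + c) ∂P =
      ∫ ω, f ω ∂P + ∫ ω, g ω ∂P + ∫ ω, h ω ∂P + ∫ ω, k ω ∂P + c := by
  rw [integral_add (f := fun ω => f ω + g ω + h ω + k ω) (((hf.add hg).add hh).add hk)
      (integrable_const c), integral_add (f := fun ω => f ω + g ω + h ω) ((hf.add hg).add hh) hk,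
    integral_add (f := fun ω => f ω + g ω) (hf.add hg) hh, integral_add hf hg, integral_const,
    probReal_univ, one_smul]

omit [IsProbabilityMeasure P] in
theorem IsSampling.map_sample {J : ℕ} (hS : IsSampling P N J K A kbar) (i : ℕ × Bool × ℕ) :
    P.map (A i) =
      uniformOn ((Finset.powersetCard J (Finset.univ : Finset (Fin N)) : Finset _) : Set _) := by
  rw [hS.law_A i]
  congr 1
  ext a
  simp

omit [IsProbabilityMeasure P] in
theorem IsSampling.ae_card {J : ℕ} (hS : IsSampling P N J K A kbar) :
    ∀ᵐ ω ∂P, ∀ i, (A i ω).card = J := by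
  rw [ae_all_iff]
  intro i
  filter_upwards [ae_mem_of_map_eq_uniformOn (hS.measurable_A i) (hS.map_sample i)] with ω hω
  exact (Finset.mem_powersetCard.1 hω).2

namespace Setup.Regular

variable (R : S.Regular) (hS : IsSampling P N S.J K A kbar)
include R hS

omit R [IsProbabilityMeasure P] in
theorem measurable_iteration [IsProbabilityMeasure P] {β : Type*} [MeasurableSpace β] (k : ℕ)
    (h : E d × (Bool → ℝ) × (Bool → E d) × (Bool → E d) × (Bool → ℝ) × (Bool → ℝ) → β) :
    Measurable fun ω => (fun A => h (S.w A k, S.δ A k, S.out A k, S.u A k, S.avgGap A k,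
      S.avgSq A k)) (path fun i => A i ω) :=
  measurable_of_dependsOn hS.measurable_A (dependsOn_comp (dependsOn_iteration k) h)

omit R in
theorem integrable_iteration {β : Type*} [NormedAddCommGroup β] (k : ℕ)
    (h : E d × (Bool → ℝ) × (Bool → E d) × (Bool → E d) × (Bool → ℝ) × (Bool → ℝ) → β) :
    Integrable (fun ω => (fun A => h (S.w A k, S.δ A k, S.out A k, S.u A k, S.avgGap A k,
      S.avgSq A k)) (path fun i => A i ω)) P :=
  integrable_of_dependsOn hS.measurable_A (dependsOn_comp (dependsOn_iteration k) h)

omit R in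
theorem integrable_δ (k : ℕ) (b : Bool) :
    Integrable (fun ω => S.δ (path fun i => A i ω) k b) P :=
  integrable_iteration hS k fun p => p.2.1 b

omit R in
theorem integrable_avgGap (k : ℕ) (b : Bool) :
    Integrable (fun ω => S.avgGap (path fun i => A i ω) k b) P :=
  integrable_iteration hS k fun p => p.2.2.2.2.1 b

omit R in
theorem integrable_avgSq (k : ℕ) (b : Bool) :
    Integrable (fun ω => S.avgSq (path fun i => A i ω) k b) P :=
  integrable_iteration hS k fun p => p.2.2.2.2.2 b

/-- The sample drawn at step `t` is independent of the current iterate, so its subgradient terms may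
be averaged over all subsets; `le_average_stepTerm` then applies pointwise. -/
theorem integral_step_le (k : ℕ) (b : Bool) (t : ℕ) :
    Integrable (fun ω => S.gap (S.level b) (S.z (path fun i => A i ω) k b t) +
      S.τ * ‖(S.z (path fun i => A i ω) k b t).1 - S.u (path fun i => A i ω) k b‖ ^ 2) P ∧
    Integrable (fun ω => S.stepTerm (S.level b) (S.w (path fun i => A i ω) k)
        (S.lam (path fun i => A i ω) k b) (S.z (path fun i => A i ω) k b t) (A (k, b, t) ω) +
      S.proxTerm (S.level b) (S.w (path fun i => A i ω) k)
        (S.z (path fun i => A i ω) k b t).1) P ∧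
    ∫ ω, (S.gap (S.level b) (S.z (path fun i => A i ω) k b t) +
      S.τ * ‖(S.z (path fun i => A i ω) k b t).1 - S.u (path fun i => A i ω) k b‖ ^ 2) ∂P ≤
    ∫ ω, (S.stepTerm (S.level b) (S.w (path fun i => A i ω) k)
        (S.lam (path fun i => A i ω) k b) (S.z (path fun i => A i ω) k b t) (A (k, b, t) ω) +
      S.proxTerm (S.level b) (S.w (path fun i => A i ω) k)
        (S.z (path fun i => A i ω) k b t).1) ∂P := by
  have hdep := dependsOn_iter (S := S) k b t
  have h1 : Integrable (fun ω => S.gap (S.level b) (S.z (path fun i => A i ω) k b t) +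
      S.τ * ‖(S.z (path fun i => A i ω) k b t).1 - S.u (path fun i => A i ω) k b‖ ^ 2) P :=
    integrable_of_dependsOn hS.measurable_A (dependsOn_comp hdep fun p =>
      S.gap (S.level b) p.2 + S.τ * ‖p.2.1 - S.proxF (S.level b) p.1.1‖ ^ 2)
  obtain ⟨h2, h3⟩ := integral_sample_eq hS.measurable_A hS.indep_A (hS.map_sample (k, b, t))
    (notMem_pastIter k b t) hdep fun p a =>
      S.stepTerm (S.level b) p.1.1 (p.1.2 b) p.2 a + S.proxTerm (S.level b) p.1.1 p.2.1
  refine ⟨h1, h2, le_of_le_of_eq ?_ h3.symm⟩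
  refine integral_mono h1 (integrable_of_dependsOn hS.measurable_A (dependsOn_comp hdep fun p =>
    ((Finset.powersetCard S.J (Finset.univ : Finset (Fin N))).card : ℝ)⁻¹ *
      ∑ a ∈ Finset.powersetCard S.J (Finset.univ : Finset (Fin N)),
        (S.stepTerm (S.level b) p.1.1 (p.1.2 b) p.2 a + S.proxTerm (S.level b) p.1.1 p.2.1)))
    fun ω => ?_
  have hc : (0 : ℝ) < (N.choose S.J : ℕ) := by exact_mod_cast Nat.choose_pos R.J_le
  have h4 := R.le_average_stepTerm (R.level_le b) (S.w (path fun i => A i ω) k)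
    (S.lam (path fun i => A i ω) k b) (S.z (path fun i => A i ω) k b t)
  beta_reduce
  rw [Finset.sum_add_distrib, Finset.sum_const, Finset.card_powersetCard, Finset.card_univ,
    Fintype.card_fin, nsmul_eq_mul, mul_add, inv_mul_cancel_left₀ hc.ne']
  exact h4

/-- The expected suboptimality of an inner run that starts close to the optimal thresholds. -/
theorem integral_avgGap_add_le (k : ℕ) (b : Bool)
    (hδ : ∫ ω, S.δ (path fun i => A i ω) k b ∂P ≤ S.D b) :
    ∫ ω, S.avgGap (path fun i => A i ω) k b ∂P +
      S.τ * ∫ ω, S.avgSq (path fun i => A i ω) k b ∂P ≤ S.τ / (2 * (k + 1)) := by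
  have hμ := R.μ_pos
  have hB := R.B_pos
  have hT : (0 : ℝ) < S.T k b := by exact_mod_cast R.T_pos k b
  set a₀ : ℝ := S.μ * (S.level b * S.B) with ha₀
  have h1 := fun t => R.integral_step_le hS k b t
  have h2 : ∫ ω, ∑ t ∈ Finset.range (S.T k b),
      (S.stepTerm (S.level b) (S.w (path fun i => A i ω) k)
        (S.lam (path fun i => A i ω) k b) (S.z (path fun i => A i ω) k b t) (A (k, b, t) ω) +
      S.proxTerm (S.level b) (S.w (path fun i => A i ω) k)
        (S.z (path fun i => A i ω) k b t).1) ∂P ≤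
      ∫ ω, (√(S.T k b) * N * S.δ (path fun i => A i ω) k b +
        (√(S.T k b) * (N * S.B * a₀) + a₀ ^ 2 / (2 * S.μ))) ∂P := by
    refine integral_mono_ae (integrable_finsetSum _ fun t _ => (h1 t).2.1)
      (((integrable_δ hS k b).const_mul _).add (integrable_const _)) ?_
    filter_upwards [hS.ae_card] with ω hω
    have h3 := R.sum_stepTerm_le (A := path fun i => A i ω) (k := k) (b := b) (fun t => hω _)
      (S.w (path fun i => A i ω) k) (S.lam (path fun i => A i ω) k b)
    refine h3.trans ?_
    have h4 := R.norm_u_sub_w_le (path fun i => A i ω) k b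
    rw [← ha₀] at h4
    change √(S.T k b) * (N * S.B * ‖S.u (path fun i => A i ω) k b - S.w (path fun i => A i ω) k‖ +
      N * S.δ (path fun i => A i ω) k b) +
      ‖S.u (path fun i => A i ω) k b - S.w (path fun i => A i ω) k‖ ^ 2 / (2 * S.μ) ≤ _
    calc _ ≤ √(S.T k b) * (N * S.B * a₀ + N * S.δ (path fun i => A i ω) k b) +
        a₀ ^ 2 / (2 * S.μ) := by gcongr
      _ = _ := by ring
  rw [integral_finsetSum _ fun t _ => (h1 t).2.1, integral_add
    ((integrable_δ hS k b).const_mul _) (integrable_const _), integral_const_mul,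
    integral_const, probReal_univ, one_smul] at h2
  have h3 := Finset.sum_le_sum fun t (_ : t ∈ Finset.range (S.T k b)) => (h1 t).2.2
  rw [← integral_finsetSum _ fun t _ => (h1 t).1] at h3
  -- Linearity of the regret in `δ` allows its expectation to be inserted here; no pathwise bound on
  -- `δ` is needed.
  have h4 := regret_bound_le R k b (a := a₀) (by positivity) le_rfl hδ
  have h5 : ∫ ω, S.avgGap (path fun i => A i ω) k b ∂P +
      S.τ * ∫ ω, S.avgSq (path fun i => A i ω) k b ∂P = (S.T k b : ℝ)⁻¹ *
      ∫ ω, ∑ t ∈ Finset.range (S.T k b), (S.gap (S.level b) (S.z (path fun i => A i ω) k b t) +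
      S.τ * ‖(S.z (path fun i => A i ω) k b t).1 - S.u (path fun i => A i ω) k b‖ ^ 2) ∂P := by
    rw [← integral_const_mul, ← integral_const_mul, ← integral_add (integrable_avgGap hS k b)
      ((integrable_avgSq hS k b).const_mul _)]
    refine integral_congr_ae (ae_of_all _ fun ω => ?_)
    simp only [avgGap, avgSq]
    rw [Finset.sum_add_distrib, ← Finset.mul_sum]
    ring
  rw [h5, inv_mul_le_iff₀ hT]
  refine (h3.trans h2).trans (le_of_eq_of_le ?_ h4)
  ring

theorem integral_avgSq_le_of_integral_δ_le (k : ℕ) (b : Bool)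
    (hδ : ∫ ω, S.δ (path fun i => A i ω) k b ∂P ≤ S.D b) :
    ∫ ω, S.avgSq (path fun i => A i ω) k b ∂P ≤ 1 / (2 * (k + 1)) := by
  have h1 := R.integral_avgGap_add_le hS k b hδ
  have h2 : 0 ≤ ∫ ω, S.avgGap (path fun i => A i ω) k b ∂P :=
    integral_nonneg fun ω => R.avgGap_nonneg _ k b
  have hτ := R.τ_pos
  have h3 : S.τ * ∫ ω, S.avgSq (path fun i => A i ω) k b ∂P ≤ S.τ * (1 / (2 * (k + 1))) := by
    rw [mul_one_div]; linarith
  exact le_of_mul_le_mul_left h3 hτ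

/-- The expected distance to the optimal thresholds stays below `D`. -/
theorem integral_δ_le (k : ℕ) (b : Bool) :
    ∫ ω, S.δ (path fun i => A i ω) k b ∂P ≤ S.D b := by
  induction k generalizing b with
  | zero =>
    have h : ∀ ω, S.δ (path fun i => A i ω) 0 b =
        Metric.infDist (S.lam₀ b) (S.LambdaStar (S.level b) S.w₀) := fun _ => rfl
    simp only [h, integral_const, probReal_univ, one_smul]
    exact le_max_left _ _
  | succ k ih =>
    have hk : (1 : ℝ) ≤ k + 1 := by
      have : (0 : ℝ) ≤ k := Nat.cast_nonneg k
      linarith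
    have hτ := R.τ_pos
    have hμ := R.μ_pos
    have hB := R.B_pos
    have hγ := R.γ_pos
    -- The terms of `D` in turn: `τ/2` covers the gap, `B` covers `(B/2)(1 + 1/2)`, and `2γ/μ`
    -- covers the factor `(3/2)γ/μ` from the errors of both runs in the outer step.
    have hsq : ∀ b, ∫ ω, S.avgSq (path fun i => A i ω) k b ∂P ≤ 1 / 2 := fun b =>
      (R.integral_avgSq_le_of_integral_δ_le hS k b (ih b)).trans
        (one_div_le_one_div_of_le (by norm_num) (by linarith))
    have hgap : ∫ ω, S.avgGap (path fun i => A i ω) k b ∂P ≤ S.τ / 2 := by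
      have h1 := R.integral_avgGap_add_le hS k b (ih b)
      have h2 : 0 ≤ S.τ * ∫ ω, S.avgSq (path fun i => A i ω) k b ∂P :=
        mul_nonneg hτ.le (integral_nonneg fun ω => avgSq_nonneg _ k b)
      have h3 : S.τ / (2 * (k + 1)) ≤ S.τ / 2 :=
        div_le_div_of_nonneg_left hτ.le (by norm_num) (by linarith)
      linarith
    set c : ℝ := S.B / (1 - S.μ * S.ρ) with hc
    have hc0 : 0 < c := div_pos hB R.one_sub_pos
    have i1 := integrable_avgGap hS (S := S) k b
    have i2 := (integrable_avgSq hS (S := S) k b).const_mul (S.B / 2)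
    have i3 := (integrable_avgSq hS (S := S) k false).const_mul (c * (S.γ / S.μ) / 2)
    have i4 := (integrable_avgSq hS (S := S) k true).const_mul (c * (S.γ / S.μ) / 2)
    set c' : ℝ := S.B / 2 + c * (S.γ / S.μ + (S.γ * S.n * S.B + S.γ * S.m * S.B)) with hc'
    have h1 : ∫ ω, S.δ (path fun i => A i ω) (k + 1) b ∂P ≤
        ∫ ω, (S.avgGap (path fun i => A i ω) k b + S.B / 2 * S.avgSq (path fun i => A i ω) k b +
          c * (S.γ / S.μ) / 2 * S.avgSq (path fun i => A i ω) k false +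
          c * (S.γ / S.μ) / 2 * S.avgSq (path fun i => A i ω) k true + c') ∂P := by
      refine integral_mono (integrable_δ hS (k + 1) b)
        ((((i1.add i2).add i3).add i4).add (integrable_const c')) fun ω => ?_
      refine (R.δ_succ_le (path fun i => A i ω) k b).trans_eq ?_
      simp only [hc', ← hc]
      ring
    rw [integral_add_add_add_const i1 i2 i3 i4, integral_const_mul, integral_const_mul,
      integral_const_mul] at h1
    have hD := D_ge (S := S) b
    rw [← hc] at hD
    have e1 := mul_le_mul_of_nonneg_left (hsq b) (show 0 ≤ S.B / 2 by positivity)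
    have e2 := mul_le_mul_of_nonneg_left (hsq false)
      (show 0 ≤ c * (S.γ / S.μ) / 2 by positivity)
    have e3 := mul_le_mul_of_nonneg_left (hsq true)
      (show 0 ≤ c * (S.γ / S.μ) / 2 by positivity)
    have e4 : 0 ≤ S.μ * (S.level b : ℝ) ^ 2 * S.B ^ 2 / 2 := by positivity
    have e5 : 0 ≤ c * (S.γ / S.μ) := by positivity
    have e6 : c * (2 * S.γ / S.μ + S.γ * S.n * S.B + S.γ * S.m * S.B) = 2 * (c * (S.γ / S.μ)) +
        c * (S.γ * S.n * S.B + S.γ * S.m * S.B) := by ring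
    have e7 : c' = S.B / 2 + c * (S.γ / S.μ) + c * (S.γ * S.n * S.B + S.γ * S.m * S.B) := by
      rw [hc']; ring
    linarith

theorem integral_avgSq_le (k : ℕ) (b : Bool) :
    ∫ ω, S.avgSq (path fun i => A i ω) k b ∂P ≤ 1 / (2 * (k + 1)) :=
  R.integral_avgSq_le_of_integral_δ_le hS k b (R.integral_δ_le hS k b)

end Setup.Regular

end Expectation

end SoRR

/-! ### The harmonic sum and the choice of `K` -/

namespace SoRR

variable {d N : ℕ}

theorem sum_one_div_le_one_add_log (K : ℕ) :
    ∑ k ∈ Finset.range K, 1 / ((k : ℝ) + 1) ≤ 1 + Real.log K := by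
  refine le_of_eq_of_le ?_ (harmonic_le_one_add_log K)
  simp [harmonic]

/-- `log (K/x) ≤ K/x - 1` reduces `log K` to `log x`, and the hypothesis says `log x ≤ K/x`. -/
theorem one_add_log_le {x K : ℝ} (hx : 0 < x) (hK : 0 < K) (h : x * Real.log x ≤ K) :
    1 + Real.log K ≤ 2 * K / x := by
  have h1 := Real.log_le_sub_one_of_pos (div_pos hK hx)
  rw [Real.log_div hK.ne' hx.ne'] at h1
  have h2 : Real.log x ≤ K / x := by rw [le_div_iff₀ hx]; linarith
  have h3 : 2 * K / x = K / x + K / x := by ring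
  linarith

/-! ### The random output index -/

section RandomIndex

variable {Ω : Type*} [MeasurableSpace Ω] {P : Measure Ω} [IsProbabilityMeasure P] {S : Setup d N}
  {K : ℕ} {A : ℕ × Bool × ℕ → Ω → Finset (Fin N)} {kbar : Ω → ℕ}

namespace Setup

/-- The outer iterate, the averaged inner iterates and the proximal points of iteration `k`. -/
noncomputable def data (S : Setup d N) (A : ℕ → Bool → ℕ → Finset (Fin N)) (k : ℕ) :
    E d × (Bool → E d) × (Bool → E d) := (S.w A k, S.out A k, S.u A k)

namespace Regular

variable (hS : IsSampling P N S.J K A kbar)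
include hS

omit [IsProbabilityMeasure P] in
theorem map_kbar : P.map kbar = uniformOn ((Finset.range K : Finset ℕ) : Set ℕ) := by
  rw [hS.law_kbar, Finset.coe_range]
  rfl

theorem measurable_data {β : Type*} [MeasurableSpace β]
    (h : E d × (Bool → E d) × (Bool → E d) → β) :
    Measurable fun ω => h (S.data (path fun i => A i ω) (kbar ω)) := by
  -- The index is discrete, so joint measurability follows from measurability for each fixed
  -- iteration.
  have h1 : Measurable fun p : ℕ × Ω => h (S.data (path fun i => A i p.2) p.1) :=
    measurable_from_prod_countable_right fun k =>
      measurable_iteration hS k fun p => h (p.1, p.2.2.1, p.2.2.2.1)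
  exact h1.comp (hS.measurable_kbar.prodMk measurable_id)

theorem integrable_data (h : E d × (Bool → E d) × (Bool → E d) → ℝ) (k : ℕ) :
    Integrable (fun ω => h (S.data (path fun i => A i ω) k)) P :=
  integrable_iteration hS k fun p => h (p.1, p.2.2.1, p.2.2.2.1)

theorem integral_data (h : E d × (Bool → E d) × (Bool → E d) → ℝ) :
    Integrable (fun ω => h (S.data (path fun i => A i ω) (kbar ω))) P ∧
      ∫ ω, h (S.data (path fun i => A i ω) (kbar ω)) ∂P =
        (K : ℝ)⁻¹ * ∑ k ∈ Finset.range K, ∫ ω, h (S.data (path fun i => A i ω) k) ∂P := by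
  have h1 := integral_comp_uniform hS.measurable_kbar (map_kbar hS)
    (Ψ := fun ω k => h (S.data (path fun i => A i ω) k))
    (fun k _ => integrable_data hS h k) fun k _ => by
      have hm : Measurable fun x : ℕ × Bool × ℕ → Finset (Fin N) => h (S.data (path x) k) :=
        measurable_of_dependsOn (A := fun i (x : ℕ × Bool × ℕ → Finset (Fin N)) => x i) (I := S.past (k + 1))
          (Φ := fun x => h (S.data (path x) k)) (fun i => measurable_pi_apply i)
          (dependsOn_comp (dependsOn_iteration k) fun p => h (p.1, p.2.2.1, p.2.2.2.1))
      exact hS.indep_kbar.comp hm measurable_id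
  simpa using h1

/-- Passing from second moments to first moments. -/
theorem norm_data_le {ε : ℝ} (hε : 0 < ε) (hK : 1 ≤ K)
    (h : E d × (Bool → E d) × (Bool → E d) → E d)
    (hsq : ∑ k ∈ Finset.range K, ∫ ω, ‖h (S.data (path fun i => A i ω) k)‖ ^ 2 ∂P ≤ K * ε ^ 2) :
    Integrable (fun ω => h (S.data (path fun i => A i ω) (kbar ω))) P ∧
      ∫ ω, ‖h (S.data (path fun i => A i ω) (kbar ω))‖ ∂P ≤ ε := by
  have hK0 : (0 : ℝ) < K := by exact_mod_cast hK
  obtain ⟨h1, _⟩ := integral_data hS fun p => ‖h p‖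
  refine ⟨(integrable_norm_iff (measurable_data hS h).aestronglyMeasurable).1 h1, ?_⟩
  obtain ⟨h3, h4⟩ := integral_data hS fun p => ‖h p‖ ^ 2
  have h5 : ∫ ω, ‖h (S.data (path fun i => A i ω) (kbar ω))‖ ^ 2 ∂P ≤ ε ^ 2 := by
    rw [h4, inv_mul_le_iff₀ hK0]
    exact hsq
  have h6 : ∫ ω, ‖h (S.data (path fun i => A i ω) (kbar ω))‖ ∂P ≤
      ∫ ω, ((2 * ε)⁻¹ * ‖h (S.data (path fun i => A i ω) (kbar ω))‖ ^ 2 + ε / 2) ∂P := by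
    refine integral_mono h1 ((h3.const_mul _).add (integrable_const _)) fun ω => ?_
    beta_reduce
    generalize ‖h (S.data (path fun i => A i ω) (kbar ω))‖ = r
    have h7 : (2 * ε)⁻¹ * r ^ 2 + ε / 2 - r = (r - ε) ^ 2 / (2 * ε) := by field_simp; ring
    have h8 : 0 ≤ (r - ε) ^ 2 / (2 * ε) := by positivity
    linarith
  rw [integral_add (h3.const_mul _) (integrable_const _), integral_const_mul, integral_const,
    probReal_univ, one_smul] at h6
  have h7 : (2 * ε)⁻¹ * ∫ ω, ‖h (S.data (path fun i => A i ω) (kbar ω))‖ ^ 2 ∂P ≤ ε / 2 := by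
    rw [inv_mul_le_iff₀ (by positivity)]
    linarith
  linarith

variable (R : S.Regular)
include R

theorem sum_integral_avgSq_le (b : Bool) :
    ∑ k ∈ Finset.range K, ∫ ω, S.avgSq (path fun i => A i ω) k b ∂P ≤
      (1 + Real.log K) / 2 := by
  refine (Finset.sum_le_sum fun k _ => R.integral_avgSq_le hS k b).trans ?_
  have h : ∀ k : ℕ, 1 / (2 * ((k : ℝ) + 1)) = 1 / ((k : ℝ) + 1) / 2 := by
    intro k; field_simp
  simp only [h]
  rw [← Finset.sum_div]
  exact div_le_div_of_nonneg_right (sum_one_div_le_one_add_log K) (by norm_num)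

theorem sum_integral_norm_out_sub_sq_le (b : Bool) :
    ∑ k ∈ Finset.range K, ∫ ω, ‖S.out (path fun i => A i ω) k b -
      S.u (path fun i => A i ω) k b‖ ^ 2 ∂P ≤ (1 + Real.log K) / 2 :=
  (Finset.sum_le_sum fun k _ => integral_mono
    (integrable_data hS (fun p => ‖p.2.1 b - p.2.2 b‖ ^ 2) k) (integrable_avgSq hS k b)
    fun _ => R.norm_out_sub_sq_le _ k b).trans (sum_integral_avgSq_le hS R b)

theorem sum_integral_norm_u_sub_u_sq_le :
    ∑ k ∈ Finset.range K, ∫ ω, ‖S.u (path fun i => A i ω) k false -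
      S.u (path fun i => A i ω) k true‖ ^ 2 ∂P ≤
    2 * S.μ ^ 2 / S.γ * (S.F (S.proxF S.m S.w₀) - S.Fstar) + 2 * (1 + Real.log K) := by
  have hi : ∀ k, Integrable (fun ω => ‖S.u (path fun i => A i ω) k false -
      S.u (path fun i => A i ω) k true‖ ^ 2) P := fun k =>
    integrable_data hS (fun p => ‖p.2.2 false - p.2.2 true‖ ^ 2) k
  have hj : ∀ k, Integrable (fun ω => 2 * (S.avgSq (path fun i => A i ω) k false +
      S.avgSq (path fun i => A i ω) k true)) P := fun k =>
    ((integrable_avgSq hS k false).add (integrable_avgSq hS k true)).const_mul 2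
  rw [← integral_finsetSum _ fun k _ => hi k]
  have h1 := integral_mono (μ := P) (integrable_finsetSum _ fun k _ => hi k)
    ((integrable_const (2 * S.μ ^ 2 / S.γ * (S.F (S.proxF S.m S.w₀) - S.Fstar))).add
      (integrable_finsetSum (Finset.range K) fun k _ => hj k))
    fun ω => R.sum_norm_u_sub_u_sq_le (path fun i => A i ω) K
  refine h1.trans ?_
  have h2 : ∀ k, ∫ ω, 2 * (S.avgSq (path fun i => A i ω) k false +
      S.avgSq (path fun i => A i ω) k true) ∂P =
      2 * (∫ ω, S.avgSq (path fun i => A i ω) k false ∂P +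
        ∫ ω, S.avgSq (path fun i => A i ω) k true ∂P) := by
    intro k
    rw [integral_const_mul, integral_add (integrable_avgSq hS k false) (integrable_avgSq hS k true)]
  have h3 := sum_integral_avgSq_le hS R false
  have h4 := sum_integral_avgSq_le hS R true
  rw [integral_add' (integrable_const _) (integrable_finsetSum _ fun k _ => hj k), integral_const,
    probReal_univ, one_smul, integral_finsetSum _ fun k _ => hj k, Finset.sum_congr rfl
    fun k _ => h2 k, ← Finset.mul_sum, Finset.sum_add_distrib]
  linarith

theorem isNearlyCritical {ε : ℝ} (hε : 0 < ε) (hK : 1 ≤ K) (hKε : S.Kbound ε ≤ K) :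
    IsNearlyCritical P (S.f S.n) (S.f S.m) ε
      fun ω => S.vbar (fun k b t => A (k, b, t) ω) (kbar ω) := by
  have hμ := R.μ_pos
  have hγ := R.γ_pos
  have hK0 : (0 : ℝ) < K := by exact_mod_cast hK
  set c : ℝ := min 1 (S.μ ^ 2) with hc
  have hc0 : 0 < c := lt_min one_pos (by positivity)
  have hc1 : c ≤ 1 := min_le_left _ _
  have hcμ : c ≤ S.μ ^ 2 := min_le_right _ _
  -- The common budget: `c = min 1 μ²` lets it serve both the distances (`q ≤ K ε²`) and the scaled
  -- residual (`q ≤ μ² K ε²`).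
  set q : ℝ := K * (c * ε ^ 2) with hq
  have hq0 : 0 < q := by positivity
  have hqε : q ≤ K * ε ^ 2 := by
    rw [hq]
    gcongr
    exact mul_le_of_le_one_left (by positivity) hc1
  have h1 : 2 * S.μ ^ 2 / S.γ * (S.F (S.proxF S.m S.w₀) - S.Fstar) ≤ q / 8 := by
    have h := (le_max_left _ _).trans hKε
    rw [← hc] at h
    have h' := mul_le_mul_of_nonneg_right h (show 0 ≤ c * ε ^ 2 / 8 by positivity)
    refine le_trans (le_of_eq ?_) (h'.trans_eq ?_)
    · field_simp; ring
    · rw [hq]; ring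
  have h2 : 1 + Real.log K ≤ q / 48 := by
    have h := (le_max_right _ _).trans hKε
    rw [← hc] at h
    refine (one_add_log_le (by positivity) hK0 h).trans_eq ?_
    rw [hq]
    field_simp
    norm_num
  have hu : ∑ k ∈ Finset.range K, ∫ ω, ‖S.u (path fun i => A i ω) k false -
      S.u (path fun i => A i ω) k true‖ ^ 2 ∂P ≤ q / 6 := by
    -- The initial gap uses `q/8` and the inner errors `2 · q/48`, together `q/6`.
    have h := sum_integral_norm_u_sub_u_sq_le hS R
    linarith
  have ho : ∑ k ∈ Finset.range K, ∫ ω, ‖S.out (path fun i => A i ω) k true -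
      S.u (path fun i => A i ω) k true‖ ^ 2 ∂P ≤ q / 96 := by
    have h := sum_integral_norm_out_sub_sq_le hS R true
    linarith
  obtain ⟨i1, b1⟩ := norm_data_le hS hε hK (fun p => S.μ⁻¹ • (p.2.2 false - p.2.2 true)) <| by
    simp only [norm_smul, mul_pow, integral_const_mul]
    rw [← Finset.mul_sum, norm_inv, Real.norm_of_nonneg hμ.le, inv_pow,
      inv_mul_le_iff₀ (by positivity)]
    refine hu.trans ?_
    have : q ≤ S.μ ^ 2 * (K * ε ^ 2) := by
      rw [hq, show (K : ℝ) * (c * ε ^ 2) = c * (K * ε ^ 2) by ring]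
      gcongr
    linarith
  obtain ⟨i2, b2⟩ := norm_data_le hS hε hK (fun p => p.2.1 true - p.2.2 true)
    ((show _ ≤ q / 96 from ho).trans (by linarith))
  obtain ⟨i3, b3⟩ := norm_data_le hS hε hK (fun p => p.2.1 true - p.2.2 false) <| by
    have h3 : ∀ k, ∫ ω, ‖S.out (path fun i => A i ω) k true -
        S.u (path fun i => A i ω) k false‖ ^ 2 ∂P ≤
        2 * ∫ ω, ‖S.out (path fun i => A i ω) k true - S.u (path fun i => A i ω) k true‖ ^ 2 ∂P +
        2 * ∫ ω, ‖S.u (path fun i => A i ω) k false - S.u (path fun i => A i ω) k true‖ ^ 2 ∂P := by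
      intro k
      have j1 := (integrable_data hS (fun p => ‖p.2.1 true - p.2.2 true‖ ^ 2) k).const_mul 2
      have j2 := (integrable_data hS (fun p => ‖p.2.2 false - p.2.2 true‖ ^ 2) k).const_mul 2
      have j3 := integrable_data hS (fun p => ‖p.2.1 true - p.2.2 false‖ ^ 2) k
      rw [← integral_const_mul, ← integral_const_mul]
      refine (integral_mono j3 (j1.add j2) fun ω => ?_).trans_eq (integral_add j1 j2)
      simp only [Pi.add_apply, data]
      generalize S.out (path fun i => A i ω) k true = p
      generalize S.u (path fun i => A i ω) k true = p'
      generalize S.u (path fun i => A i ω) k false = p''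
      have h4 := norm_sub_le (p - p') (p'' - p')
      rw [show p - p' - (p'' - p') = p - p'' by abel] at h4
      have h5 := pow_le_pow_left₀ (norm_nonneg _) h4 2
      nlinarith [sq_nonneg (‖p - p'‖ - ‖p'' - p'‖)]
    refine (Finset.sum_le_sum fun k _ => h3 k).trans ?_
    rw [Finset.sum_add_distrib, ← Finset.mul_sum, ← Finset.mul_sum]
    linarith
  refine ⟨_, _, _, measurable_data hS fun p => S.μ⁻¹ • (p.2.2 false - p.2.2 true),
    measurable_data hS fun p => p.2.2 true, measurable_data hS fun p => p.2.2 false,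
    ae_of_all _ fun ω => ?_, i1, i2, i3, b1, b2, b3⟩
  obtain ⟨ha, hb⟩ := R.norm_smul_sub_mem_subdiff (path fun i => A i ω) (kbar ω)
  refine ⟨_, ha, _, hb, ?_⟩
  simp only [data]
  module

end Regular

end Setup

end RandomIndex

/-! ### Complexity -/

namespace Setup.Regular

variable {S : Setup d N} (R : S.Regular)
include R

theorem exists_K_le : ∃ C : ℝ, 0 ≤ C ∧ ∀ ε : ℝ, 0 < ε → ε < 1 →
    (S.K ε : ℝ) ≤ C * ε⁻¹ ^ 2 * (1 + Real.log (1 / ε)) := by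
  have hμ := R.μ_pos
  set c : ℝ := min 1 (S.μ ^ 2) with hc
  have hc0 : 0 < c := lt_min one_pos (by positivity)
  set a : ℝ := |16 * S.μ ^ 2 / (S.γ * c) * (S.F (S.proxF S.m S.w₀) - S.Fstar)|
  set b : ℝ := 96 / c
  have hb : 0 < b := by positivity
  refine ⟨a + b * (|Real.log b| + 2) + 1, by positivity, fun ε hε hε1 => ?_⟩
  have he : 1 ≤ ε⁻¹ := (one_le_inv₀ hε).2 hε1.le
  have he2 : 1 ≤ ε⁻¹ ^ 2 := one_le_pow₀ he
  have hl : 0 ≤ Real.log (1 / ε) := by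
    rw [one_div]; exact Real.log_nonneg he
  set l : ℝ := 1 + Real.log (1 / ε) with hl'
  have hl1 : 1 ≤ l := by linarith
  have hel : 1 ≤ ε⁻¹ ^ 2 * l := one_le_mul_of_one_le_of_one_le he2 hl1
  have h1 : 16 * S.μ ^ 2 / (S.γ * c * ε ^ 2) * (S.F (S.proxF S.m S.w₀) - S.Fstar) ≤
      a * (ε⁻¹ ^ 2 * l) := by
    have e : 16 * S.μ ^ 2 / (S.γ * c * ε ^ 2) * (S.F (S.proxF S.m S.w₀) - S.Fstar) =
        16 * S.μ ^ 2 / (S.γ * c) * (S.F (S.proxF S.m S.w₀) - S.Fstar) * ε⁻¹ ^ 2 := by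
      have := R.γ_pos
      field_simp
    rw [e]
    have h0 : 0 ≤ a := abs_nonneg _
    calc _ ≤ a * ε⁻¹ ^ 2 := by gcongr; exact le_abs_self _
      _ ≤ a * (ε⁻¹ ^ 2 * l) := by
        gcongr
        exact le_mul_of_one_le_right (by positivity) hl1
  have h2 : 96 / (c * ε ^ 2) * Real.log (96 / (c * ε ^ 2)) ≤
      b * (|Real.log b| + 2) * (ε⁻¹ ^ 2 * l) := by
    have e : 96 / (c * ε ^ 2) = b * ε⁻¹ ^ 2 := by simp only [b]; field_simp
    have e' : Real.log (b * ε⁻¹ ^ 2) ≤ (|Real.log b| + 2) * l := by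
      rw [Real.log_mul hb.ne' (by positivity), Real.log_pow, ← one_div]
      have := le_abs_self (Real.log b)
      have := le_mul_of_one_le_right (abs_nonneg (Real.log b)) hl1
      push_cast
      linarith
    rw [e]
    calc b * ε⁻¹ ^ 2 * Real.log (b * ε⁻¹ ^ 2) ≤ b * ε⁻¹ ^ 2 * ((|Real.log b| + 2) * l) := by gcongr
      _ = _ := by ring
  have ha0 : 0 ≤ a * (ε⁻¹ ^ 2 * l) := mul_nonneg (abs_nonneg _) (by linarith)
  have hb0 : 0 ≤ b * (|Real.log b| + 2) * (ε⁻¹ ^ 2 * l) :=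
    mul_nonneg (by positivity) (by linarith)
  have h3 : S.Kbound ε ≤ a * (ε⁻¹ ^ 2 * l) + b * (|Real.log b| + 2) * (ε⁻¹ ^ 2 * l) :=
    max_le (by rw [← hc]; linarith) (by rw [← hc]; linarith)
  rw [K, Nat.cast_max, Nat.cast_one]
  refine max_le (by nlinarith) ?_
  have h4 : (⌈S.Kbound ε⌉₊ : ℝ) ≤
      a * (ε⁻¹ ^ 2 * l) + b * (|Real.log b| + 2) * (ε⁻¹ ^ 2 * l) + 1 :=
    (Nat.cast_le.2 (Nat.ceil_mono h3)).trans (Nat.ceil_lt_add_one (by linarith)).le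
  linarith

omit R in
theorem exists_T_le (b : Bool) : ∃ C : ℝ, 0 ≤ C ∧ ∀ k : ℕ, (S.T k b : ℝ) ≤ C * (k + 1) ^ 2 := by
  set a₁ : ℝ := 144 * (N : ℝ) ^ 2 * S.D b ^ 2 / (S.μ⁻¹ - S.ρ) ^ 2
  set a₂ : ℝ := 4 * (N : ℝ) ^ 2 * S.μ ^ 2 * (S.level b) ^ 2 * S.B ^ 2 / (S.μ⁻¹ - S.ρ) ^ 2
  set a₃ : ℝ := |6 * S.μ * (S.level b) ^ 2 * S.B ^ 2 / (2 * (S.μ⁻¹ - S.ρ) ^ 2)|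
  have h₁ : 0 ≤ a₁ := by positivity
  have h₂ : 0 ≤ a₂ := by positivity
  have h₃ : 0 ≤ a₃ := abs_nonneg _
  refine ⟨a₁ + a₂ + a₃ + 1, by positivity, fun k => ?_⟩
  have hk : (1 : ℝ) ≤ k + 1 := by
    have : (0 : ℝ) ≤ k := Nat.cast_nonneg k
    linarith
  have hk2 : (k : ℝ) + 1 ≤ (k + 1) ^ 2 := by nlinarith
  have e₃ : 6 * S.μ * (S.level b) ^ 2 * S.B ^ 2 * (k + 1) / (2 * (S.μ⁻¹ - S.ρ) ^ 2) ≤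
      a₃ * (k + 1) ^ 2 := by
    calc _ = 6 * S.μ * (S.level b) ^ 2 * S.B ^ 2 / (2 * (S.μ⁻¹ - S.ρ) ^ 2) * (k + 1) := by ring
      _ ≤ a₃ * (k + 1) ^ 2 := by
        gcongr
        exact le_abs_self _
  have p₁ : 0 ≤ a₁ * ((k : ℝ) + 1) ^ 2 := by positivity
  have p₂ : 0 ≤ a₂ * ((k : ℝ) + 1) ^ 2 := by positivity
  have p₃ : 0 ≤ a₃ * ((k : ℝ) + 1) ^ 2 := by positivity
  have h : max (max
      (144 * (N : ℝ) ^ 2 * S.D b ^ 2 * (k + 1) ^ 2 / (S.μ⁻¹ - S.ρ) ^ 2)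
      (4 * (N : ℝ) ^ 2 * S.μ ^ 2 * (S.level b) ^ 2 * S.B ^ 2 * (k + 1) ^ 2 / (S.μ⁻¹ - S.ρ) ^ 2))
      (6 * S.μ * (S.level b) ^ 2 * S.B ^ 2 * (k + 1) / (2 * (S.μ⁻¹ - S.ρ) ^ 2)) ≤
      a₁ * (k + 1) ^ 2 + a₂ * (k + 1) ^ 2 + a₃ * (k + 1) ^ 2 := by
    refine max_le (max_le ?_ ?_) (by linarith)
    · have : 144 * (N : ℝ) ^ 2 * S.D b ^ 2 * (k + 1) ^ 2 / (S.μ⁻¹ - S.ρ) ^ 2 =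
        a₁ * (k + 1) ^ 2 := by simp only [a₁]; ring
      linarith
    · have : 4 * (N : ℝ) ^ 2 * S.μ ^ 2 * (S.level b) ^ 2 * S.B ^ 2 * (k + 1) ^ 2 /
        (S.μ⁻¹ - S.ρ) ^ 2 = a₂ * (k + 1) ^ 2 := by simp only [a₂]; ring
      linarith
  have h4 := (Nat.cast_le (α := ℝ)).2 (Nat.ceil_mono h) |>.trans
    (Nat.ceil_lt_add_one (by linarith)).le
  unfold T
  linarith

theorem complexity : ∃ (C : ℝ) (p : ℕ), ∀ ε : ℝ, 0 < ε → ε < 1 →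
    (S.K ε : ℝ) ≤ C * ε⁻¹ ^ 2 * (1 + Real.log (1 / ε)) ^ p ∧
    (S.totalSteps (S.K ε) : ℝ) ≤ C * ε⁻¹ ^ 6 * (1 + Real.log (1 / ε)) ^ p := by
  obtain ⟨C, hC0, hC⟩ := R.exists_K_le
  obtain ⟨Cm, hm0, hm⟩ := exists_T_le (S := S) false
  obtain ⟨Cn, hn0, hn⟩ := exists_T_le (S := S) true
  -- The total is at most `(Cm + Cn) K³`, so the single logarithm in the bound on `K` is cubed;
  -- hence the exponent 3.
  refine ⟨C + (Cm + Cn) * C ^ 3, 3, fun ε hε hε1 => ?_⟩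
  have hK := hC ε hε hε1
  have hl : 0 ≤ Real.log (1 / ε) := by
    rw [one_div]; exact Real.log_nonneg ((one_le_inv₀ hε).2 hε1.le)
  set l : ℝ := 1 + Real.log (1 / ε)
  have hl1 : 1 ≤ l := by linarith
  have hl3 : l ≤ l ^ 3 := le_self_pow₀ hl1 (by norm_num)
  constructor
  · calc (S.K ε : ℝ) ≤ C * ε⁻¹ ^ 2 * l := hK
      _ ≤ (C + (Cm + Cn) * C ^ 3) * ε⁻¹ ^ 2 * l ^ 3 := by
        gcongr
        exact le_add_of_nonneg_right (by positivity)
  · have h1 : (S.totalSteps (S.K ε) : ℝ) ≤ (Cm + Cn) * (S.K ε : ℝ) ^ 3 := by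
      unfold totalSteps
      push_cast
      calc _ ≤ ∑ k ∈ Finset.range (S.K ε), (Cm + Cn) * (S.K ε : ℝ) ^ 2 := by
            refine Finset.sum_le_sum fun k hk => ?_
            have hk' : (k : ℝ) + 1 ≤ S.K ε := by exact_mod_cast Finset.mem_range.1 hk
            calc (S.T k false : ℝ) + S.T k true ≤ Cm * (k + 1) ^ 2 + Cn * (k + 1) ^ 2 :=
                  add_le_add (hm k) (hn k)
              _ = (Cm + Cn) * ((k : ℝ) + 1) ^ 2 := by ring
              _ ≤ _ := by gcongr
        _ = _ := by
          rw [Finset.sum_const, Finset.card_range, nsmul_eq_mul]; ring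
    calc (S.totalSteps (S.K ε) : ℝ) ≤ (Cm + Cn) * (C * ε⁻¹ ^ 2 * l) ^ 3 := by
          refine h1.trans ?_
          gcongr
      _ = (Cm + Cn) * C ^ 3 * ε⁻¹ ^ 6 * l ^ 3 := by ring
      _ ≤ (C + (Cm + Cn) * C ^ 3) * ε⁻¹ ^ 6 * l ^ 3 := by
        gcongr
        exact le_add_of_nonneg_left hC0

end Setup.Regular

end SoRR

theorem corollary1 {d N : ℕ} (S : SoRR.Setup d N)
    (hmn : S.m < S.n) (hnN : S.n ≤ N)
    (hJ : 1 ≤ S.J) (hJN : S.J ≤ N)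
    (hdiff : ∀ j, Differentiable ℝ (S.s j))
    (hL : 0 ≤ S.L)
    (hsmooth : ∀ j w v, ‖∇ (S.s j) w - ∇ (S.s j) v‖ ≤ S.L * ‖w - v‖)
    (hB : 0 < S.B)
    (hgrad : ∀ j w, ‖∇ (S.s j) w‖ ≤ S.B)
    (hF : BddBelow (Set.range S.F))
    (hμ : 0 < S.μ) (hμρ : S.ρ < S.μ⁻¹)
    (hγ : 0 < S.γ) (hγL : S.γ ≤ 1 / S.Lμ) :
    (∀ ε : ℝ, 0 < ε → ∀ K : ℕ, 1 ≤ K → S.Kbound ε ≤ K →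
      ∀ (Ω : Type*) [MeasurableSpace Ω] (P : Measure Ω) [IsProbabilityMeasure P]
        (A : ℕ × Bool × ℕ → Ω → Finset (Fin N)) (kbar : Ω → ℕ),
        SoRR.IsSampling P N S.J K A kbar →
        SoRR.IsNearlyCritical P (S.f S.n) (S.f S.m) ε
          (fun ω => S.vbar (fun k b t => A (k, b, t) ω) (kbar ω))) ∧
    (∃ (C : ℝ) (p : ℕ), ∀ ε : ℝ, 0 < ε → ε < 1 →
      (S.K ε : ℝ) ≤ C * ε⁻¹ ^ 2 * (1 + Real.log (1 / ε)) ^ p ∧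
      (S.totalSteps (S.K ε) : ℝ) ≤ C * ε⁻¹ ^ 6 * (1 + Real.log (1 / ε)) ^ p) := by
  have R : S.Regular := ⟨hmn, hnN, hJ, hJN, hdiff, hL, hsmooth, hB, hgrad, hF, hμ, hμρ, hγ, hγL⟩
  exact ⟨fun ε hε K hK hKε Ω _ P _ A kbar hS => SoRR.Setup.Regular.isNearlyCritical hS R hε hK hKε, R.complexity⟩
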